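/- **Setting.** Let $L$ be a lattice of rank $n$ and $L_{\mathbb R}=L\otimes\mathbb R$. A *simplicial multi-fan* $\Delta=(\Sigma,C,w^{\pm})$ in $L$ consists of: a finite simplicial complex $\Sigma$, with the empty set included as a simplex, where $\Sigma^{(k)}$ denotes the set of simplices with $k$ vertices, $\Sigma^{(n)}\ne\emptyset$; a map $C$ sending each $J\in\Sigma^{(k)}$ to a $k$-dimensional rational simplicial cone $C(J)\subset L_{\mathbb R}$ such that $I\mapsto C(I)$ is an isomorphism from the faces of $J$ onto the faces of $C(J)$; and maps $w^\pm:\Sigma^{(n)}\to\mathbb Z_{\ge0}$. Put $w=w^+-w^-$. A vector of $L_{\mathbb R}$ is *generic* if it lies on no linear subspace spanned by a cone $C(J)$ of dimension less than $n$. For $K\in\Sigma$, let $L^K_{\mathbb R}$ be the quotient of $L_{\mathbb R}$ by the span of $C(K)$, and for $J\supset K$ let $C_K(J)$ be the image of $C(J)$ in it; $x\in L^K_{\mathbb R}$ is generic if it lies on no subspace spanned by a cone $C_K(J)$ with $K\subset J\in\Sigma$ and $|J|<n$. $\Delta$ is *complete* if for every $K\in\Sigma$ the integer $\sum w(I)$,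 summed over the $I\in\Sigma^{(n)}$ with $I\supset K$ and $x\in C_K(I)$, is the same for all generic $x\in L^K_{\mathbb R}$. A set of *prescribed edge vectors* $\mathcal V=\{v_i\}_{i\in\Sigma^{(1)}}$ consists of vectors $v_i\in L$, not necessarily primitive, such that $v_i$ generates the ray $C(\{i\})$. For $I\in\Sigma^{(n)}$ let $L_{I,\mathcal V}\subset L$ be the sublattice generated by $\{v_i\}_{i\in I}$, $H_I=L/L_{I,\mathcal V}$ (a finite group), and $\{u_i^I\}_{i\in I}$ the basis of $L_{\mathbb R}^*$ dual to $\{v_i\}_{i\in I}$. Put $L_{\mathcal V}=\bigcap_{I\in\Sigma^{(n)}}L_{I,\mathcal V}$. Condition (P) is: $L_{I,\mathcal V}=L_{\mathcal V}$ for all $I\in\Sigma^{(n)}$. Let $H_T^*(\Delta)=\mathbb Z[x_i: i\in\Sigma^{(1)}]/\bigl(\prod_{i\in J}x_i: J\notin\Sigma\bigr)$, with each $x_i$ in degree $2$, let $H_T^2(\Delta)$ be its part of degree $2$, and let $L^*=\operatorname{Hom}(L,\mathbb Z)$ map to $H^2_T(\Delta)$ by $u\mapsto\sum_i\langle u,v_i\rangle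 x_i$. The first Chern class $c_1(\Delta,\mathcal V)$ is the image of $\sum_i x_i$ in the quotient of $H_T^2(\Delta)$ by the image of $L^*$; it is divisible by $N$ if it is $N$ times an element of that quotient. For $\tau$ in the upper half plane and $\sigma,z\in\mathbb C$ put $q=e^{2\pi i\tau}$, $\zeta=e^{2\pi i\sigma}$, $t=e^{2\pi i z}$, $t^{1/2}=e^{\pi i z}$, $$\Phi(z,\tau)=(t^{1/2}-t^{-1/2})\prod_{k\ge1}\frac{(1-tq^k)(1-t^{-1}q^k)}{(1-q^k)^2},\qquad \phi(z,\tau,\sigma)=\frac{\Phi(z+\sigma,\tau)}{\Phi(z,\tau)}.$$ For a generic $v\in L_{\mathcal V}$, the equivariant elliptic genus along $v$ is the meromorphic function of $z$ $$\varphi^v(\Delta,\mathcal V;z,\tau,\sigma)=\sum_{I\in\Sigma^{(n)}}\frac{w(I)}{|H_I|}\sum_{h\in H_I}\prod_{i\in I}\phi\bigl(\langle u_i^I,-zv-v(h)\rangle,\tau,\sigma\bigr),$$ where $v(h)\in L$ represents $h\in H_I$ (the value does not depend on the representatives). It is called of *level* $N$ when $\zeta^N=1$ and $\zeta\ne1$.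 **Theorem.** Let $\Delta$ be a complete simplicial multi-fan and $\mathcal V$ a set of prescribed edge vectors satisfying condition (P). Let $v\in L_{\mathcal V}$ be a generic vector. Assume that $c_1(\Delta,\mathcal V)$ is divisible by an integer $N>1$. Then the equivariant elliptic genus $\varphi^v(\Delta,\mathcal V;z,\tau,\sigma)$ of level $N$ along $v$ is rigid: for every $\tau$ in the upper half plane and every $\sigma\in\mathbb C$ with $\zeta^N=1$, $\zeta\neq1$, it is constant as a meromorphic function of $z$. That is, the set of $z\in\mathbb C$ at which no denominator $\Phi(\langle u_i^I,-zv-v(h)\rangle,\tau)$ vanishes has a closed discrete complement, and $\varphi^v(\Delta,\mathcal V;z,\tau,\sigma)$ takes one and the same value at all $z$ in this set. -/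

import Mathlib

open scoped TensorProduct

noncomputable section

/-- The inclusion `x ↦ 1 ⊗ x` of a lattice `L` in the real vector space `L_ℝ = ℝ ⊗ L`. -/
def latticeIncl (L : Type*) [AddCommGroup L] : L →ₗ[ℤ] (ℝ ⊗[ℤ] L) :=
  TensorProduct.mk ℤ ℝ L 1

/-- A simplicial multi-fan `Δ = (Σ, C, w^±)` in a lattice `L`, whose set `Σ^{(1)}` of vertices is
the finite type `ι`.  The dimension of `Δ` is the rank of `L`. -/
structure SimplicialMultiFan (ι : Type*) [Fintype ι] [DecidableEq ι]
    (L : Type*) [AddCommGroup L] where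
  /-- The simplices of the augmented simplicial complex `Σ`; a simplex `J` of `Σ^{(k)}` is
  a set of `k` vertices. -/
  faces : Finset (Finset ι)
  empty_mem : ∅ ∈ faces
  singleton_mem : ∀ i, {i} ∈ faces
  down_closed : ∀ J ∈ faces, ∀ I, I ⊆ J → I ∈ faces
  /-- The cone `C(J)` in `L_ℝ` attached to a simplex `J` (only the values on `Σ` matter). -/
  cone : Finset ι → PointedCone ℝ (ℝ ⊗[ℤ] L)
  /-- For `J` in `Σ^{(k)}`, `C(J)` is a rational simplicial cone of dimension `k` (it is generated
  by `k` linearly independent lattice vectors), and `I ↦ C(I)` maps the faces `I` of `J`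
  isomorphically onto the faces of the cone `C(J)` (the cones generated by the subsets of these
  vectors). -/
  cone_simplicial : ∀ J ∈ faces, ∃ b : ι → L,
    LinearIndependent ℝ (fun j : J => latticeIncl L (b j)) ∧
      ∀ I, I ⊆ J → cone I = PointedCone.hull ℝ ((fun i => latticeIncl L (b i)) '' (I : Set ι))
  /-- The weights `w^+` and `w^-` (only the values on `Σ^{(n)}` matter). -/
  wPlus : Finset ι → ℕ
  wMinus : Finset ι → ℕ
  /-- `Σ^{(n)}` is not empty. -/
  exists_facet : ∃ I ∈ faces, I.card = Module.finrank ℤ L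

namespace SimplicialMultiFan

variable {ι : Type*} [Fintype ι] [DecidableEq ι] {L : Type*} [AddCommGroup L]

/-- The set `Σ^{(n)}` of simplices of top dimension, `n` being the rank of `L`. -/
def facets (Δ : SimplicialMultiFan ι L) : Finset (Finset ι) :=
  Δ.faces.filter (fun I => I.card = Module.finrank ℤ L)

/-- `w(I) = w^+(I) - w^-(I)`. -/
def w (Δ : SimplicialMultiFan ι L) (I : Finset ι) : ℤ := (Δ.wPlus I : ℤ) - (Δ.wMinus I : ℤ)

/-- The linear subspace `(L_K)_ℝ` of `L_ℝ` spanned by the cone `C(K)`. -/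
def coneSpan (Δ : SimplicialMultiFan ι L) (K : Finset ι) : Submodule ℝ (ℝ ⊗[ℤ] L) :=
  Submodule.span ℝ (Δ.cone K : Set (ℝ ⊗[ℤ] L))

/-- A vector of `L_ℝ` is generic if it lies on no linear subspace spanned by a cone of
dimension less than `n`. -/
def IsGeneric (Δ : SimplicialMultiFan ι L) (x : ℝ ⊗[ℤ] L) : Prop :=
  ∀ J ∈ Δ.faces, J.card < Module.finrank ℤ L → x ∉ Δ.coneSpan J

/-- The cone `C_K(J)` of the projected multi-fan `Δ_K`: the image of `C(J)` in the quotient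
`L^K_ℝ = L_ℝ / (L_K)_ℝ`. -/
def projCone (Δ : SimplicialMultiFan ι L) (K J : Finset ι) :
    PointedCone ℝ ((ℝ ⊗[ℤ] L) ⧸ Δ.coneSpan K) :=
  (Δ.cone J).map (Δ.coneSpan K).mkQ

/-- Generic vectors of `L^K_ℝ` for the projected multi-fan `Δ_K`, whose simplices are the `J ∈ Σ`
containing `K`, with `dim C_K(J) = |J| - |K|`, and whose dimension is `n - |K|`. -/
def IsProjGeneric (Δ : SimplicialMultiFan ι L) (K : Finset ι)
    (x : (ℝ ⊗[ℤ] L) ⧸ Δ.coneSpan K) : Prop :=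
  ∀ J ∈ Δ.faces, K ⊆ J → J.card < Module.finrank ℤ L →
    x ∉ Submodule.span ℝ (Δ.projCone K J : Set ((ℝ ⊗[ℤ] L) ⧸ Δ.coneSpan K))

open Classical in
/-- The integer `d_x`, the sum of the `w(I)` over the `I ∈ Σ_K` of top dimension with
`x ∈ C_K(I)`, for the projected multi-fan `Δ_K`. -/
def projDegreeAt (Δ : SimplicialMultiFan ι L) (K : Finset ι)
    (x : (ℝ ⊗[ℤ] L) ⧸ Δ.coneSpan K) : ℤ :=
  ∑ I ∈ Δ.facets.filter (fun I => K ⊆ I ∧ x ∈ Δ.projCone K I), Δ.w I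

/-- The projected multi-fan `Δ_K` is pre-complete: `d_x` is the same for all generic `x`. -/
def IsProjPreComplete (Δ : SimplicialMultiFan ι L) (K : Finset ι) : Prop :=
  ∀ x y, Δ.IsProjGeneric K x → Δ.IsProjGeneric K y → Δ.projDegreeAt K x = Δ.projDegreeAt K y

/-- `Δ` is complete: all projected multi-fans `Δ_K`, `K ∈ Σ` (among them `Δ = Δ_∅`), are
pre-complete. -/
def IsComplete (Δ : SimplicialMultiFan ι L) : Prop :=
  ∀ K ∈ Δ.faces, Δ.IsProjPreComplete K

/-- A set `𝒱 = {v_i}` of prescribed edge vectors: `v_i ∈ L` generates the ray `C({i})`; it need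
not be primitive. -/
structure EdgeVectors (Δ : SimplicialMultiFan ι L) where
  vec : ι → L
  hull_eq : ∀ i, Δ.cone {i} = PointedCone.hull ℝ {latticeIncl L (vec i)}

namespace EdgeVectors

variable {Δ : SimplicialMultiFan ι L}

/-- The edge vectors of a simplex are linearly independent. -/
theorem linearIndependent (V : Δ.EdgeVectors) {J : Finset ι} (hJ : J ∈ Δ.faces) :
    LinearIndependent ℝ (fun j : J => latticeIncl L (V.vec j)) := by
  obtain ⟨b, hb, hcone⟩ := Δ.cone_simplicial J hJ
  have key : ∀ j : J, ∃ c : ℝ, c ≠ 0 ∧ latticeIncl L (V.vec j) = c • latticeIncl L (b j) := by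
    intro j
    have h1 := hcone {(j : ι)} (by simp)
    rw [V.hull_eq j] at h1
    simp only [Finset.coe_singleton, Set.image_singleton] at h1
    have h2 : latticeIncl L (V.vec j) ∈
        PointedCone.hull ℝ ({latticeIncl L (b j)} : Set (ℝ ⊗[ℤ] L)) := by
      rw [← h1]; exact Submodule.subset_span rfl
    have h3 : latticeIncl L (b j) ∈
        PointedCone.hull ℝ ({latticeIncl L (V.vec j)} : Set (ℝ ⊗[ℤ] L)) := by
      rw [h1]; exact Submodule.subset_span rfl
    obtain ⟨c, hc⟩ := Submodule.mem_span_singleton.1 h2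
    obtain ⟨d, hd⟩ := Submodule.mem_span_singleton.1 h3
    refine ⟨(c : ℝ), ?_, hc.symm⟩
    intro h0
    have hc0 : c = 0 := Subtype.ext h0
    rw [← hc, hc0, zero_smul] at hd
    exact hb.ne_zero j (hd.symm.trans (smul_zero d))
  choose c hc hcv using key
  have : (fun j : J => latticeIncl L (V.vec j)) =
      (fun j : J => Units.mk0 (c j) (hc j)) • (fun j : J => latticeIncl L (b j)) := by
    funext j
    rw [hcv j]; rfl
  rw [this]
  exact hb.units_smul _

/-- The sublattice `L_{I,𝒱}` of `L` generated by the `v_i`, `i ∈ I`. -/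
def lat (V : Δ.EdgeVectors) (I : Finset ι) : Submodule ℤ L :=
  Submodule.span ℤ (V.vec '' (I : Set ι))

/-- `L_𝒱`, the intersection of the `L_{I,𝒱}` over `I ∈ Σ^{(n)}`. -/
def latInf (V : Δ.EdgeVectors) : Submodule ℤ L := ⨅ I ∈ Δ.facets, V.lat I

/-- The global type condition (P): `L_{I,𝒱} = L_𝒱` for all `I ∈ Σ^{(n)}`. -/
def GlobalType (V : Δ.EdgeVectors) : Prop := ∀ I ∈ Δ.facets, V.lat I = V.latInf

section Genus

variable [Module.Free ℤ L] [Module.Finite ℤ L]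

/-- For `I ∈ Σ^{(n)}`, the basis `{v_i}_{i ∈ I}` of the vector space `L_ℝ`. -/
def facetBasis (V : Δ.EdgeVectors) (I : Δ.facets) :
    Module.Basis I.1 ℝ (ℝ ⊗[ℤ] L) :=
  Module.Basis.mk (V.linearIndependent (Finset.mem_filter.1 I.2).1) (by
    have hli := V.linearIndependent (Finset.mem_filter.1 I.2).1
    have hcard : Fintype.card I.1 = Module.finrank ℝ (ℝ ⊗[ℤ] L) := by
      rw [Fintype.card_coe, (Finset.mem_filter.1 I.2).2, Module.finrank_baseChange]
    exact (hli.span_eq_top_of_card_eq_finrank' hcard).ge)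

/-- The pairing `⟨u_i^I, x⟩` of the lattice vector `x` with the member `u_i^I` of the basis dual
to `{v_i}_{i ∈ I}`. -/
def pairing (V : Δ.EdgeVectors) (I : Δ.facets) (i : I.1) (x : L) : ℝ :=
  (V.facetBasis I).coord i (latticeIncl L x)

/-- `H_I = L / L_{I,𝒱}`. -/
abbrev quot (V : Δ.EdgeVectors) (I : Δ.facets) : Type _ := L ⧸ V.lat I.1

theorem finite_quot (V : Δ.EdgeVectors) (I : Δ.facets) : Finite (V.quot I) := by
  have hli := V.linearIndependent (Finset.mem_filter.1 I.2).1
  have hZ : LinearIndependent ℤ (fun j : I.1 => V.vec j) := by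
    have h1 : LinearIndependent ℤ (fun j : I.1 => latticeIncl L (V.vec j)) :=
      hli.restrict_scalars (R := ℤ) (by
        intro a b hab
        simpa using hab)
    exact LinearIndependent.of_comp (latticeIncl L) h1
  apply Submodule.finiteQuotientOfFreeOfRankEq
  have hr : V.vec '' (I.1 : Set ι) = Set.range (fun j : I.1 => V.vec j) := by
    ext x; simp
  rw [lat, hr, finrank_span_eq_card hZ, Fintype.card_coe, (Finset.mem_filter.1 I.2).2]

instance (V : Δ.EdgeVectors) (I : Δ.facets) : Fintype (V.quot I) :=
  have := V.finite_quot I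
  Fintype.ofFinite _

end Genus

end EdgeVectors

/-! ### The first Chern class -/

/-- The ideal of `ℤ[x_i : i ∈ Σ^{(1)}]` generated by the `∏_{i ∈ J} x_i` with `J ∉ Σ`. -/
def faceIdeal (Δ : SimplicialMultiFan ι L) : Ideal (MvPolynomial ι ℤ) :=
  Ideal.span {p | ∃ J : Finset ι, J ∉ Δ.faces ∧ p = ∏ i ∈ J, MvPolynomial.X i}

/-- The equivariant cohomology `H_T^*(Δ)`: the face ring of `Σ`. -/
abbrev FaceRing (Δ : SimplicialMultiFan ι L) : Type _ := MvPolynomial ι ℤ ⧸ Δ.faceIdeal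

/-- `H_T^2(Δ)`: the part of the face ring spanned by the images of the linear forms (each `x_i`
has degree 2). -/
def H2T (Δ : SimplicialMultiFan ι L) : Submodule ℤ Δ.FaceRing :=
  (MvPolynomial.homogeneousSubmodule ι ℤ 1).map
    (Ideal.Quotient.mkₐ ℤ Δ.faceIdeal).toLinearMap

/-- The class `x_i ∈ H_T^2(Δ)`. -/
def xClass (Δ : SimplicialMultiFan ι L) (i : ι) : Δ.H2T :=
  ⟨Ideal.Quotient.mk Δ.faceIdeal (MvPolynomial.X i),
    Submodule.mem_map.2 ⟨MvPolynomial.X i, MvPolynomial.isHomogeneous_X ℤ i, rfl⟩⟩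

namespace EdgeVectors

variable {Δ : SimplicialMultiFan ι L}

/-- The map `H^2(BT) = L^* → H_T^2(Δ)`, `u ↦ ∑_i ⟨u, v_i⟩ x_i`. -/
def fromH2BT (V : Δ.EdgeVectors) : Module.Dual ℤ L →ₗ[ℤ] Δ.H2T where
  toFun u := ∑ i, u (V.vec i) • Δ.xClass i
  map_add' u u' := by simp [add_smul, Finset.sum_add_distrib]
  map_smul' a u := by simp [mul_smul, Finset.smul_sum]

/-- The first Chern class `c_1(Δ,𝒱)`: the image of the equivariant first Chern class `∑_i x_i` in
`H_T^2(Δ) / H^2(BT)`. -/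
def firstChern (V : Δ.EdgeVectors) : Δ.H2T ⧸ LinearMap.range V.fromH2BT :=
  (LinearMap.range V.fromH2BT).mkQ (∑ i, Δ.xClass i)

/-- `c_1(Δ,𝒱)` is divisible by `N`. -/
def ChernDivisible (V : Δ.EdgeVectors) (N : ℕ) : Prop :=
  ∃ y : Δ.H2T ⧸ LinearMap.range V.fromH2BT, V.firstChern = N • y

end EdgeVectors

end SimplicialMultiFan

/-! ### The elliptic genus -/

/-- `Φ(z,τ) = (t^{1/2} - t^{-1/2}) ∏_{k ≥ 1} (1 - t q^k)(1 - t⁻¹ q^k) / (1 - q^k)²` with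
`t = e^{2πiz}`, `t^{1/2} = e^{πiz}` and `q = e^{2πiτ}`. -/
def ellipticPhi (z : ℂ) (τ : UpperHalfPlane) : ℂ :=
  (Complex.exp (Real.pi * Complex.I * z) - Complex.exp (-(Real.pi * Complex.I * z))) *
    ∏' k : ℕ,
      ((1 - Complex.exp (2 * Real.pi * Complex.I * z) *
            Complex.exp (2 * Real.pi * Complex.I * τ) ^ (k + 1)) *
        (1 - Complex.exp (-(2 * Real.pi * Complex.I * z)) *
            Complex.exp (2 * Real.pi * Complex.I * τ) ^ (k + 1))) /
      (1 - Complex.exp (2 * Real.pi * Complex.I * τ) ^ (k + 1)) ^ 2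

/-- `ϕ(z,τ,σ) = Φ(z+σ,τ) / Φ(z,τ)`; it is used only where `Φ(z,τ) ≠ 0`. -/
def ellipticQuot (z : ℂ) (τ : UpperHalfPlane) (σ : ℂ) : ℂ :=
  ellipticPhi (z + σ) τ / ellipticPhi z τ

namespace SimplicialMultiFan.EdgeVectors

variable {ι : Type*} [Fintype ι] [DecidableEq ι] {L : Type*} [AddCommGroup L]
  [Module.Free ℤ L] [Module.Finite ℤ L] {Δ : SimplicialMultiFan ι L}

/-- The number `⟨u_i^I, -zv - v(h)⟩`, where `v(h) ∈ L` is a representative of `h ∈ H_I`.  Another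
representative changes it by an integer, and `ϕ` has period 1 in its first variable. -/
def genusArg (V : Δ.EdgeVectors) (v : L) (z : ℂ) (I : Δ.facets) (h : V.quot I) (i : I.1) : ℂ :=
  -(z * (V.pairing I i v : ℂ)) - (V.pairing I i (Quotient.out h) : ℂ)

/-- The equivariant elliptic genus `φ^v(Δ,𝒱;z,τ,σ)` along `v`, given by
`∑_I w(I)/|H_I| ∑_h ∏_{i ∈ I} ϕ(⟨u_i^I, -zv - v(h)⟩, τ, σ)`. -/
def ellipticGenus (V : Δ.EdgeVectors) (v : L) (z : ℂ) (τ : UpperHalfPlane) (σ : ℂ) : ℂ :=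
  ∑ I : Δ.facets, ((Δ.w I.1 : ℂ) / (Fintype.card (V.quot I) : ℂ)) *
    ∑ h : V.quot I, ∏ i : I.1, ellipticQuot (V.genusArg v z I h i) τ σ

/-- The points `z` at which no denominator in the formula for `φ^v(Δ,𝒱;z,τ,σ)` vanishes. -/
def regularSet (V : Δ.EdgeVectors) (v : L) (τ : UpperHalfPlane) : Set ℂ :=
  {z | ∀ (I : Δ.facets) (h : V.quot I) (i : I.1), ellipticPhi (V.genusArg v z I h i) τ ≠ 0}

end SimplicialMultiFan.EdgeVectors

end

/-! ### The product `∏ (1 - w q^k)` -/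

/-! The genus is a function of `z` whose absolute value has periods `1` and `τ`, and all its poles
cancel; Liouville's theorem then makes it constant.

Under (P) all groups `H_I` coincide, so the genus is a multiple of a sum, over common
representatives `l`, of the functions `genusTerm`, and each of these can be treated alone. Since `v
∈ L_𝒱`, the numbers `⟨u_i^I, v⟩` are integers, which gives the period `1`. A shift by `τ` multiplies
the summand of `I` by `ζ` to the power `∑_i ⟨u_i^I, v⟩`. Divisibility of `c_1` provides `u ∈ L^*`
with `u(v_i) ≡ 1` mod `N` (`ChernDivisible.exists_dual`), so this multiplier is `ζ^{u(v)}` for every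
`I` (`prod_zpow_coordinates`).

The main point is the cancellation of poles (`genusTerm_isBigO_one`). At a point `z₀`, let `K` be
the set of those `i ∈ I` whose factor has no pole there. By (P), the facets with the same `K` are
exactly those containing `K`. On this star the summands have the common form: a constant times
`s^{-(n-|K|)}` times `w(I) ∏ f_i(s⟨u_i^I, v⟩) / ∏_{i ∈ I \ K} ⟨u_i^I, v⟩`, where `s = z - z₀` and
the analytic `f_i` do not depend on `I`. The sum over the star is a localization sum for the
projected multi-fan at `K`, of dimension `n - |K|`. Such sums vanish on monomials of smaller degree
(`localizationSum_eq_zero`), hence on analytic data to order `n - |K|` (`isBigO_analytic`), and this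
kills the pole. The vanishing rests on linear relations among the `x_i` and on a balancing condition
at each simplex of codimension one, which comes from completeness and (P)
(`sum_weight_mul_dual_eq_zero`). -/

theorem multipliable_one_sub_mul_pow {q : ℂ} (hq : ‖q‖ < 1) (w : ℂ) :
    Multipliable fun k : ℕ => 1 - w * q ^ (k + 1) := by
  simp_rw [sub_eq_add_neg]
  apply multipliable_one_add_of_summable
  simp only [norm_neg, norm_mul, norm_pow]
  exact ((summable_nat_add_iff 1).mpr
    (summable_geometric_of_lt_one (norm_nonneg _) hq)).mul_left _

theorem tprod_one_sub_mul_pow_ne_zero {q : ℂ} (hq : ‖q‖ < 1) {w : ℂ}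
    (h : ∀ k : ℕ, w * q ^ (k + 1) ≠ 1) : ∏' k : ℕ, (1 - w * q ^ (k + 1)) ≠ 0 := by
  simp_rw [sub_eq_add_neg]
  refine tprod_one_add_ne_zero_of_summable (f := fun k => -(w * q ^ (k + 1))) (fun k => ?_) ?_
  · rw [← sub_eq_add_neg]
    exact sub_ne_zero.2 (h k).symm
  · simp only [norm_neg, norm_mul, norm_pow]
    exact ((summable_nat_add_iff 1).mpr
      (summable_geometric_of_lt_one (norm_nonneg _) hq)).mul_left _

theorem tprod_one_sub_mul_pow_eq {q : ℂ} (hq : ‖q‖ < 1) (w : ℂ) :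
    ∏' k : ℕ, (1 - w * q ^ (k + 1)) = (1 - w * q) * ∏' k : ℕ, (1 - w * q * q ^ (k + 1)) := by
  have h := multipliable_one_sub_mul_pow hq (w * q)
  rw [tprod_eq_zero_mul']
  · simp only [zero_add, pow_one]
    congr 2
    funext k
    ring
  · refine h.congr fun k => ?_
    ring

/-- On a compact set the terms `w q^(k+1)` are dominated by a geometric series, so the product
converges locally uniformly. -/
theorem differentiable_tprod_one_sub_mul_pow {q : ℂ} (hq : ‖q‖ < 1) :
    Differentiable ℂ fun w : ℂ => ∏' k : ℕ, (1 - w * q ^ (k + 1)) := by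
  have hloc : HasProdLocallyUniformlyOn (fun (k : ℕ) (w : ℂ) => 1 + -(w * q ^ (k + 1)))
      (fun w : ℂ => ∏' k : ℕ, (1 + -(w * q ^ (k + 1)))) Set.univ := by
    apply hasProdLocallyUniformlyOn_of_forall_compact isOpen_univ
    intro K _ hcK
    obtain ⟨C, hC⟩ := hcK.isBounded.exists_norm_le
    have hs : Summable fun k : ℕ => C * ‖q‖ ^ (k + 1) :=
      ((summable_nat_add_iff 1).mpr
        (summable_geometric_of_lt_one (norm_nonneg _) hq)).mul_left _
    refine hs.hasProdUniformlyOn_nat_one_add hcK (.of_forall fun k w hw => ?_)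
      (fun _ => by fun_prop)
    rw [norm_neg, norm_mul, norm_pow]
    exact mul_le_mul_of_nonneg_right (hC w hw) (by positivity)
  have hd := hloc.differentiableOn (.of_forall fun _ => by
    simpa [Finset.prod_fn] using DifferentiableOn.finsetProd (fun _ _ => by fun_prop))
    isOpen_univ
  simpa [sub_eq_add_neg, differentiableOn_univ] using hd

/-! ### The function `Φ` -/

theorem UpperHalfPlane.norm_nome_lt_one (τ : UpperHalfPlane) :
    ‖Complex.exp (2 * Real.pi * Complex.I * τ)‖ < 1 := by
  simpa using UpperHalfPlane.norm_exp_two_pi_I_lt_one τ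

theorem UpperHalfPlane.tprod_nome_ne_zero (τ : UpperHalfPlane) :
    ∏' k : ℕ, (1 - 1 * Complex.exp (2 * Real.pi * Complex.I * τ) ^ (k + 1)) ≠ 0 := by
  refine tprod_one_sub_mul_pow_ne_zero τ.norm_nome_lt_one fun k hk => ?_
  rw [one_mul] at hk
  have := congrArg norm hk
  rw [norm_pow, norm_one] at this
  exact absurd this (pow_lt_one₀ (norm_nonneg _) τ.norm_nome_lt_one (by omega)).ne

theorem ellipticPhi_eq (z : ℂ) (τ : UpperHalfPlane) :
    ellipticPhi z τ =
      (Complex.exp (Real.pi * Complex.I * z) - Complex.exp (-(Real.pi * Complex.I * z))) *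
      ((∏' k : ℕ, (1 - Complex.exp (2 * Real.pi * Complex.I * z) *
          Complex.exp (2 * Real.pi * Complex.I * τ) ^ (k + 1))) *
        (∏' k : ℕ, (1 - Complex.exp (-(2 * Real.pi * Complex.I * z)) *
          Complex.exp (2 * Real.pi * Complex.I * τ) ^ (k + 1))) /
        (∏' k : ℕ, (1 - 1 * Complex.exp (2 * Real.pi * Complex.I * τ) ^ (k + 1))) ^ 2) := by
  have hq := τ.norm_nome_lt_one
  have h0 := multipliable_one_sub_mul_pow hq 1
  have h1 := multipliable_one_sub_mul_pow hq (Complex.exp (2 * Real.pi * Complex.I * z))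
  have h2 := multipliable_one_sub_mul_pow hq (Complex.exp (-(2 * Real.pi * Complex.I * z)))
  rw [ellipticPhi, ← h0.tprod_pow, ← h1.tprod_mul h2, ← (h1.mul h2).tprod_div₀ (h0.pow 2)]
  · simp only [one_mul]
  · rw [h0.tprod_pow]
    exact pow_ne_zero 2 τ.tprod_nome_ne_zero

theorem differentiable_ellipticPhi (τ : UpperHalfPlane) :
    Differentiable ℂ fun z => ellipticPhi z τ := by
  have hd := differentiable_tprod_one_sub_mul_pow τ.norm_nome_lt_one
  simp_rw [ellipticPhi_eq]
  refine Differentiable.mul (by fun_prop) (Differentiable.div_const (Differentiable.mul ?_ ?_) _)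
  · exact hd.comp (g := fun w : ℂ => ∏' k : ℕ, (1 - w * _)) (by fun_prop)
  · exact hd.comp (g := fun w : ℂ => ∏' k : ℕ, (1 - w * _)) (by fun_prop)

theorem ellipticPhi_zero (τ : UpperHalfPlane) : ellipticPhi 0 τ = 0 := by
  simp [ellipticPhi]

/-- `Φ` has no zeros outside `ℤ + ℤτ`. -/
theorem ellipticPhi_ne_zero {z : ℂ} {τ : UpperHalfPlane} (h : ∀ m n : ℤ, z ≠ m + n * τ) :
    ellipticPhi z τ ≠ 0 := by
  have hpi : (2 * Real.pi * Complex.I : ℂ) ≠ 0 := Complex.two_pi_I_ne_zero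
  have hexp : ∀ (x : ℂ) (k : ℕ), Complex.exp x *
      Complex.exp (2 * Real.pi * Complex.I * τ) ^ k
      = Complex.exp (x + k * (2 * Real.pi * Complex.I * τ)) := by
    intro x k
    rw [← Complex.exp_nat_mul, ← Complex.exp_add]
  rw [ellipticPhi_eq]
  -- The prefactor and the two products account for the lattice points with `n = 0`, `n < 0` and `n
  -- > 0` respectively.
  refine mul_ne_zero (fun h0 => ?_) (div_ne_zero (mul_ne_zero ?_ ?_)
    (pow_ne_zero 2 τ.tprod_nome_ne_zero))
  · obtain ⟨n, hn⟩ := Complex.exp_eq_exp_iff_exists_int.1 (sub_eq_zero.1 h0)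
    apply h n 0
    have : 2 * Real.pi * Complex.I * z = 2 * Real.pi * Complex.I * n := by
      linear_combination hn
    simpa using mul_left_cancel₀ hpi this
  · refine tprod_one_sub_mul_pow_ne_zero τ.norm_nome_lt_one fun k hk => ?_
    rw [hexp, Complex.exp_eq_one_iff] at hk
    obtain ⟨n, hn⟩ := hk
    apply h n (-(k + 1))
    have : 2 * Real.pi * Complex.I * z =
        2 * Real.pi * Complex.I * (n + (-(k + 1)) * τ) := by
      push_cast at hn
      linear_combination hn
    simpa using mul_left_cancel₀ hpi this
  · refine tprod_one_sub_mul_pow_ne_zero τ.norm_nome_lt_one fun k hk => ?_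
    rw [hexp, Complex.exp_eq_one_iff] at hk
    obtain ⟨n, hn⟩ := hk
    apply h (-n) (k + 1)
    have : 2 * Real.pi * Complex.I * z =
        2 * Real.pi * Complex.I * (-n + (k + 1) * τ) := by
      push_cast at hn
      linear_combination -hn
    simpa using mul_left_cancel₀ hpi this

/-- The quotient of products equals `1` at the origin, so the derivative is that of the prefactor,
`2πi`. -/
theorem deriv_ellipticPhi_zero_ne_zero (τ : UpperHalfPlane) :
    deriv (fun z => ellipticPhi z τ) 0 ≠ 0 := by
  have hd := differentiable_tprod_one_sub_mul_pow τ.norm_nome_lt_one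
  set E : ℂ → ℂ := fun z =>
      ((∏' k : ℕ, (1 - Complex.exp (2 * Real.pi * Complex.I * z) *
          Complex.exp (2 * Real.pi * Complex.I * τ) ^ (k + 1))) *
        (∏' k : ℕ, (1 - Complex.exp (-(2 * Real.pi * Complex.I * z)) *
          Complex.exp (2 * Real.pi * Complex.I * τ) ^ (k + 1))) /
        (∏' k : ℕ, (1 - 1 * Complex.exp (2 * Real.pi * Complex.I * τ) ^ (k + 1))) ^ 2) with hE
  have hEd : Differentiable ℂ E := by
    refine Differentiable.div_const (Differentiable.mul ?_ ?_) _
    · exact hd.comp (g := fun w : ℂ => ∏' k : ℕ, (1 - w * _)) (by fun_prop)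
    · exact hd.comp (g := fun w : ℂ => ∏' k : ℕ, (1 - w * _)) (by fun_prop)
  have hE0 : E 0 = 1 := by
    simp only [hE, mul_zero, neg_zero, Complex.exp_zero, ← pow_two]
    exact div_self (pow_ne_zero 2 τ.tprod_nome_ne_zero)
  have hs : HasDerivAt (fun z : ℂ => Complex.exp (Real.pi * Complex.I * z) -
      Complex.exp (-(Real.pi * Complex.I * z))) (2 * Real.pi * Complex.I) 0 := by
    have h1 : HasDerivAt (fun z : ℂ => Real.pi * Complex.I * z) (Real.pi * Complex.I) 0 := by
      simpa using (hasDerivAt_id (0 : ℂ)).const_mul (Real.pi * Complex.I : ℂ)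
    have h2 := h1.cexp.sub h1.neg.cexp
    refine h2.congr_deriv ?_
    simp
    ring
  have hmul := hs.mul (hEd 0).hasDerivAt
  have : (fun z => ellipticPhi z τ) = (fun z : ℂ => Complex.exp (Real.pi * Complex.I * z) -
      Complex.exp (-(Real.pi * Complex.I * z))) * E := by
    funext z
    exact ellipticPhi_eq z τ
  rw [this, hmul.deriv, hE0]
  simp [Complex.I_ne_zero, Real.pi_ne_zero]

theorem ellipticPhi_add_one (z : ℂ) (τ : UpperHalfPlane) :
    ellipticPhi (z + 1) τ = -ellipticPhi z τ := by
  have h1 : Complex.exp (Real.pi * Complex.I * (z + 1)) =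
      -Complex.exp (Real.pi * Complex.I * z) := by
    rw [mul_add, mul_one, Complex.exp_add, Complex.exp_pi_mul_I]; ring
  have h2 : Complex.exp (-(Real.pi * Complex.I * (z + 1))) =
      -Complex.exp (-(Real.pi * Complex.I * z)) := by
    rw [Complex.exp_neg, h1, Complex.exp_neg, inv_neg]
  have h3 : Complex.exp (2 * Real.pi * Complex.I * (z + 1)) =
      Complex.exp (2 * Real.pi * Complex.I * z) := by
    rw [mul_add, mul_one, Complex.exp_add, Complex.exp_two_pi_mul_I, mul_one]
  have h4 : Complex.exp (-(2 * Real.pi * Complex.I * (z + 1))) =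
      Complex.exp (-(2 * Real.pi * Complex.I * z)) := by
    rw [Complex.exp_neg, h3, Complex.exp_neg]
  rw [ellipticPhi, ellipticPhi, h1, h2, h3, h4]
  ring

/-- Replacing `t` by `tq` removes the factor `1 - tq` from one product and adds `1 - t⁻¹` to the
other; together with the change of the prefactor this leaves `-q^{-1/2} t⁻¹`. -/
theorem ellipticPhi_add_tau (z : ℂ) (τ : UpperHalfPlane) :
    ellipticPhi (z + τ) τ =
      -Complex.exp (-(Real.pi * Complex.I * τ)) * Complex.exp (-(2 * Real.pi * Complex.I * z)) *
        ellipticPhi z τ := by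
  have hq := τ.norm_nome_lt_one
  set q := Complex.exp (2 * Real.pi * Complex.I * τ) with hqdef
  set a := Complex.exp (Real.pi * Complex.I * z) with ha
  set b := Complex.exp (Real.pi * Complex.I * τ) with hb
  have ha0 : a ≠ 0 := Complex.exp_ne_zero _
  have hb0 : b ≠ 0 := Complex.exp_ne_zero _
  have hqb : q = b ^ 2 := by
    rw [hqdef, hb, ← Complex.exp_nat_mul]; congr 1; push_cast; ring
  have h1 : Complex.exp (Real.pi * Complex.I * (z + τ)) = a * b := by
    rw [mul_add, Complex.exp_add]
  have h2 : Complex.exp (2 * Real.pi * Complex.I * (z + τ)) = a ^ 2 * q := by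
    rw [mul_add, Complex.exp_add, ha, ← Complex.exp_nat_mul]
    congr 2; push_cast; ring
  have h3 : Complex.exp (2 * Real.pi * Complex.I * z) = a ^ 2 := by
    rw [ha, ← Complex.exp_nat_mul]
    congr 1; push_cast; ring
  have e1 := tprod_one_sub_mul_pow_eq hq (a ^ 2)
  have e2 := tprod_one_sub_mul_pow_eq hq ((a ^ 2 * q)⁻¹)
  have hq0 : q ≠ 0 := Complex.exp_ne_zero _
  have h5 : (a ^ 2 * q)⁻¹ * q = (a ^ 2)⁻¹ := by field_simp
  rw [h5] at e2
  rw [ellipticPhi_eq, ellipticPhi_eq, Complex.exp_neg, Complex.exp_neg, Complex.exp_neg,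
    Complex.exp_neg, Complex.exp_neg, h1, h2, h3, ← hqdef, e1, e2, ← ha, ← hb]
  generalize ∏' k : ℕ, (1 - a ^ 2 * q * q ^ (k + 1)) = A
  generalize ∏' k : ℕ, (1 - (a ^ 2)⁻¹ * q ^ (k + 1)) = B
  generalize ∏' k : ℕ, (1 - 1 * q ^ (k + 1)) = C
  rw [hqb]
  field_simp
  ring

/-! ### The function `ϕ` -/

theorem ellipticQuot_add_one (z : ℂ) (τ : UpperHalfPlane) (σ : ℂ) :
    ellipticQuot (z + 1) τ σ = ellipticQuot z τ σ := by
  rw [ellipticQuot, add_right_comm, ellipticPhi_add_one, ellipticPhi_add_one, neg_div_neg_eq,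
    ellipticQuot]

/-- The multipliers of numerator and denominator differ by `ζ⁻¹`. At the zeros of `Φ` both sides are
`0` because `x / 0 = 0`, so no point has to be excluded. -/
theorem ellipticQuot_add_tau (z : ℂ) (τ : UpperHalfPlane) (σ : ℂ) :
    ellipticQuot (z + τ) τ σ =
      (Complex.exp (2 * Real.pi * Complex.I * σ))⁻¹ * ellipticQuot z τ σ := by
  rw [ellipticQuot, add_right_comm, ellipticPhi_add_tau, ellipticPhi_add_tau, mul_div_mul_comm,
    mul_div_mul_left _ _ (neg_ne_zero.2 (Complex.exp_ne_zero _)), ← Complex.exp_sub,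
    ← Complex.exp_neg, ellipticQuot]
  congr 2
  ring

theorem ellipticQuot_add_int (z : ℂ) (τ : UpperHalfPlane) (σ : ℂ) (m : ℤ) :
    ellipticQuot (z + m) τ σ = ellipticQuot z τ σ := by
  have hp : Function.Periodic (fun z => ellipticQuot z τ σ) 1 :=
    fun z => ellipticQuot_add_one z τ σ
  simpa using hp.int_mul m z

theorem ellipticQuot_add_int_mul_tau (z : ℂ) (τ : UpperHalfPlane) (σ : ℂ) (n : ℤ) :
    ellipticQuot (z + n * τ) τ σ =
      Complex.exp (2 * Real.pi * Complex.I * σ) ^ (-n) * ellipticQuot z τ σ := by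
  have h0 := Complex.exp_ne_zero (2 * Real.pi * Complex.I * σ)
  induction n with
  | zero => simp
  | succ n ih =>
    have h := ellipticQuot_add_tau (z + n * τ) τ σ
    rw [show z + ((n + 1 : ℤ) : ℂ) * τ = z + n * τ + τ by push_cast; ring, h]
    push_cast at ih
    rw [ih, ← mul_assoc, neg_add, zpow_add₀ h0, zpow_neg_one]
    ring
  | pred n ih =>
    have h := ellipticQuot_add_tau (z + ((-n - 1 : ℤ) : ℂ) * τ) τ σ
    rw [show z + ((-n - 1 : ℤ) : ℂ) * τ + τ = z + ((-n : ℤ) : ℂ) * τ by push_cast; ring, ih] at h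
    rw [neg_sub, sub_neg_eq_add, zpow_add₀ h0, zpow_one]
    rw [neg_neg] at h
    rw [mul_assoc, h]
    field_simp

noncomputable section LevelGenus

open scoped TensorProduct
open Asymptotics Filter Topology

/-! ### Vanishing of localization sums -/

/-- Weights `w` on a family `F` of `n`-element sets `I`, together with nonzero numbers `a I i`
(`i ∈ I`), the values `⟨u_i^I, v⟩` of the dual bases of a fan at a generic vector, and numbers
`t I i j`, the values `⟨u_i^I, v_j⟩`, such that the weights are balanced around each set
of `n - 1` elements. -/
structure BalancedWeights {k ι : Type*} [Field k] [Fintype ι] [DecidableEq ι]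
    (F : Finset (Finset ι)) (n : ℕ) (w : Finset ι → k) (a : Finset ι → ι → k)
    (t : Finset ι → ι → ι → k) : Prop where
  card_eq : ∀ I ∈ F, I.card = n
  ne_zero : ∀ I ∈ F, ∀ i ∈ I, a I i ≠ 0
  eq_zero : ∀ I ∈ F, ∀ i ∉ I, a I i = 0
  dual_self : ∀ I ∈ F, ∀ i ∈ I, t I i i = 1
  dual_ne : ∀ I ∈ F, ∀ i ∈ I, ∀ j ∈ I, j ≠ i → t I i j = 0
  expand : ∀ I ∈ F, ∀ i ∈ I, ∀ J ∈ F, a I i = ∑ j ∈ J, t I i j * a J j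
  balanced : ∀ I ∈ F, ∀ i ∈ I,
    ∑ J ∈ F with I.erase i ⊆ J, w J * ∑ j ∈ J \ I.erase i, t I i j = 0

/-- The localization sum over the star of `K` of the monomial `∏_{i ∈ m} x_i`. -/
def localizationSum {k ι : Type*} [Field k] [DecidableEq ι] (F : Finset (Finset ι))
    (w : Finset ι → k) (a : Finset ι → ι → k) (K : Finset ι) (m : Multiset ι) : k :=
  ∑ I ∈ F with K ⊆ I, w I * (m.map (a I)).prod / ∏ i ∈ I \ K, a I i

theorem localizationSum_eq_zero_of_forall_not_subset {k ι : Type*} [Field k] [DecidableEq ι]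
    {F : Finset (Finset ι)} {w : Finset ι → k} {a : Finset ι → ι → k} {K : Finset ι}
    (hK : ∀ I ∈ F, ¬ K ⊆ I)
    (m : Multiset ι) : localizationSum F w a K m = 0 := by
  rw [localizationSum, Finset.filter_false_of_mem hK, Finset.sum_empty]

namespace BalancedWeights

variable {k ι : Type*} [Field k] [Fintype ι] [DecidableEq ι]
  {F : Finset (Finset ι)} {n : ℕ} {w : Finset ι → k} {a : Finset ι → ι → k}
  {t : Finset ι → ι → ι → k}

/-- `x_j` restricts to zero at the facets without `j`; at the others it cancels one factor of the
denominator, which passes from the star of `K` to that of `K ∪ {j}`. -/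
theorem localizationSum_cons (h : BalancedWeights F n w a t) {K : Finset ι} {j : ι} (hj : j ∉ K)
    (m : Multiset ι) :
    localizationSum F w a K (j ::ₘ m) = localizationSum F w a (insert j K) m := by
  rw [localizationSum, localizationSum, Finset.sum_filter, Finset.sum_filter]
  refine Finset.sum_congr rfl fun I hI => ?_
  by_cases hK : K ⊆ I
  · by_cases hjI : j ∈ I
    · rw [if_pos hK, if_pos (Finset.insert_subset hjI hK), Multiset.map_cons, Multiset.prod_cons,
        ← Finset.mul_prod_erase _ _ (Finset.mem_sdiff.2 ⟨hjI, hj⟩), ← Finset.sdiff_insert,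
        mul_left_comm, mul_div_mul_left _ _ (h.ne_zero I hI j hjI)]
    · rw [if_pos hK, if_neg (fun hs => hjI (hs (Finset.mem_insert_self _ _))), Multiset.map_cons,
        Multiset.prod_cons, h.eq_zero I hI j hjI]
      simp
  · rw [if_neg hK, if_neg (fun hs => hK ((Finset.subset_insert _ _).trans hs))]

/-- The linear form `∑_j ⟨u_i^I, v_j⟩ x_j` restricts to the same constant `a I i` at every facet, by
`expand`. This relation trades a scalar for a variable. -/
theorem mul_localizationSum (h : BalancedWeights F n w a t) (K : Finset ι) (m : Multiset ι)
    {I : Finset ι} (hI : I ∈ F) {i : ι} (hi : i ∈ I) :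
    a I i * localizationSum F w a K m = ∑ j, t I i j * localizationSum F w a K (j ::ₘ m) := by
  simp_rw [localizationSum, Finset.mul_sum]
  rw [Finset.sum_comm]
  refine Finset.sum_congr rfl fun J hJ => ?_
  have hJF := (Finset.mem_filter.1 hJ).1
  have hs : ∑ j, t I i j * a J j = a I i := by
    rw [h.expand I hI i hi J hJF]
    refine (Finset.sum_subset (Finset.subset_univ _) fun j _ hj => ?_).symm
    rw [h.eq_zero J hJF j hj, mul_zero]
  rw [← hs, Finset.sum_mul]
  refine Finset.sum_congr rfl fun j _ => ?_
  rw [Multiset.map_cons, Multiset.prod_cons]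
  ring

/-- Descending induction on `K`: multiplying by some `a I i` with `i ∈ I \ K` turns the sum into a
combination of the sums for `K ∪ {j}`, `j ∉ K`. When `|K| = n - 1` this combination is the balancing
condition itself. -/
theorem localizationSum_zero (h : BalancedWeights F n w a t) (K : Finset ι) (hK : K.card < n) :
    localizationSum F w a K 0 = 0 := by
  by_cases hex : ∃ I ∈ F, K ⊆ I
  swap
  · push Not at hex
    exact localizationSum_eq_zero_of_forall_not_subset hex 0
  obtain ⟨I, hI, hKI⟩ := hex
  have hss : K ⊂ I := hKI.ssubset_of_ne fun he => by
    rw [he, h.card_eq I hI] at hK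
    exact hK.false
  obtain ⟨i, hi, hiK⟩ := Finset.exists_of_ssubset hss
  refine (mul_eq_zero.1 ?_).resolve_left (h.ne_zero I hI i hi)
  rw [h.mul_localizationSum K 0 hI hi]
  have hvan : ∀ j ∈ K, t I i j = 0 := fun j hj =>
    h.dual_ne I hI i hi j (hKI hj) fun hji => hiK (hji ▸ hj)
  rcases Nat.lt_or_ge (K.card + 1) n with hlt | hge
  · refine Finset.sum_eq_zero fun j _ => ?_
    by_cases hj : j ∈ K
    · rw [hvan j hj, zero_mul]
    · have hc : (insert j K).card = K.card + 1 := Finset.card_insert_of_notMem hj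
      rw [h.localizationSum_cons hj, h.localizationSum_zero (insert j K) (by omega), mul_zero]
  · have hKe : K = I.erase i := by
      refine Finset.eq_of_subset_of_card_le (fun x hx => Finset.mem_erase.2
        ⟨fun hxi => hiK (hxi ▸ hx), hKI hx⟩) ?_
      rw [Finset.card_erase_of_mem hi, h.card_eq I hI]
      omega
    have hb := h.balanced I hI i hi
    rw [← hKe] at hb
    rw [← hb]
    simp_rw [localizationSum, Finset.mul_sum]
    rw [Finset.sum_comm]
    refine Finset.sum_congr rfl fun J hJ => ?_
    obtain ⟨hJF, hKJ⟩ := Finset.mem_filter.1 hJ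
    have hcard : (J \ K).card = 1 := by
      have := Finset.card_sdiff_add_card_eq_card hKJ
      rw [h.card_eq J hJF] at this
      omega
    obtain ⟨b, hb⟩ := Finset.card_eq_one.1 hcard
    have hbJ : b ∈ J \ K := hb ▸ Finset.mem_singleton_self b
    rw [hb, Finset.sum_singleton, Finset.prod_singleton,
      Finset.sum_eq_single b (fun j _ hjb => ?_) (by simp)]
    · have := h.ne_zero J hJF b (Finset.mem_sdiff.1 hbJ).1
      simp only [Multiset.cons_zero, Multiset.map_singleton, Multiset.prod_singleton]
      field_simp
    · by_cases hj : j ∈ K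
      · rw [hvan j hj, zero_mul]
      · have : j ∉ J := fun hjJ => hjb (Finset.mem_singleton.1
          (hb ▸ Finset.mem_sdiff.2 ⟨hjJ, hj⟩))
        simp [h.eq_zero J hJF j this]
termination_by n - K.card

/-- The localization sum of a monomial of degree less than the dimension `n - |K|` of the star of
`K` is zero. -/
theorem localizationSum_eq_zero (h : BalancedWeights F n w a t) (m : Multiset ι) :
    ∀ K : Finset ι, K.card + m.card < n → localizationSum F w a K m = 0 := by
  induction m using Multiset.induction_on with
  | empty => exact fun K hK => h.localizationSum_zero K (by simpa using hK)
  | cons i m ih =>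
    intro K hK
    rw [Multiset.card_cons] at hK
    have hins : ∀ j ∉ K, localizationSum F w a K (j ::ₘ m) = 0 := fun j hj => by
      have hc : (insert j K).card = K.card + 1 := Finset.card_insert_of_notMem hj
      rw [h.localizationSum_cons hj]
      exact ih _ (by omega)
    -- A variable outside `K` enlarges `K`. One inside `K` is first replaced, by means of the
    -- relation given by `u_i^I` with `I ⊇ K`, by variables outside `K`: among the elements of `K`
    -- only `i` has a nonzero coefficient.
    by_cases hi : i ∈ K
    swap
    · exact hins i hi
    by_cases hex : ∃ I ∈ F, K ⊆ I
    swap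
    · push Not at hex
      exact localizationSum_eq_zero_of_forall_not_subset hex _
    obtain ⟨I, hI, hKI⟩ := hex
    have hm := h.mul_localizationSum K m hI (hKI hi)
    rw [ih K (by omega), mul_zero, Finset.sum_eq_single i (fun j _ hj => ?_) (by simp),
      h.dual_self I hI i (hKI hi), one_mul] at hm
    · exact hm.symm
    · by_cases hjK : j ∈ K
      · rw [h.dual_ne I hI i (hKI hi) j (hKI hjK) hj, zero_mul]
      · rw [hins j hjK, mul_zero]

end BalancedWeights

/-! ### The analytic version -/

theorem AnalyticAt.exists_polynomial_isBigO {f : ℂ → ℂ} (hf : AnalyticAt ℂ f 0) (m : ℕ) :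
    ∃ P : Polynomial ℂ, (fun y => f y - P.eval y) =O[𝓝 0] fun y => y ^ m := by
  obtain ⟨p, hp⟩ := hf
  refine ⟨∑ k ∈ Finset.range m, Polynomial.C (p.coeff k) * Polynomial.X ^ k, ?_⟩
  have h := hp.isBigO_sub_partialSum_pow m
  simp only [zero_add] at h
  refine (h.congr_left fun y => ?_).trans (IsBigO.of_bound 1 (Eventually.of_forall fun y => ?_))
  · rw [FormalMultilinearSeries.partialSum, Polynomial.eval_finsetSum]
    congr 1
    refine Finset.sum_congr rfl fun k _ => ?_
    rw [FormalMultilinearSeries.apply_eq_prod_smul_coeff]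
    simp only [Polynomial.eval_mul, Polynomial.eval_C, Polynomial.eval_pow, Polynomial.eval_X,
      smul_eq_mul, Finset.prod_const, Finset.card_univ, Fintype.card_fin]
    exact mul_comm _ _
  · simp

theorem isBigO_prod_sub_prod {ι : Type*} (s : Finset ι) {f g : ι → ℂ → ℂ} {r : ℂ → ℂ}
    {l : Filter ℂ} (hf : ∀ i ∈ s, f i =O[l] (fun _ => (1 : ℂ)))
    (hg : ∀ i ∈ s, g i =O[l] (fun _ => (1 : ℂ)))
    (hfg : ∀ i ∈ s, (fun z => f i z - g i z) =O[l] r) :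
    (fun z => ∏ i ∈ s, f i z - ∏ i ∈ s, g i z) =O[l] r := by
  classical
  induction s using Finset.induction_on with
  | empty => simpa using isBigO_zero r l
  | insert i s hi ih =>
    have h1 := ih (fun j hj => hf j (Finset.mem_insert_of_mem hj))
      (fun j hj => hg j (Finset.mem_insert_of_mem hj))
      (fun j hj => hfg j (Finset.mem_insert_of_mem hj))
    have h2 := hfg i (Finset.mem_insert_self _ _)
    have h3 : (fun z => ∏ j ∈ s, g j z) =O[l] fun _ => (1 : ℂ) := by
      simpa using IsBigO.finsetProd (s := s) (g := fun _ _ => (1 : ℂ))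
        fun j hj => hg j (Finset.mem_insert_of_mem hj)
    have h4 := (hf i (Finset.mem_insert_self _ _)).mul h1
    have h5 := h2.mul h3
    simp only [one_mul, mul_one] at h4 h5
    refine (h4.add h5).congr_left fun z => ?_
    rw [Finset.prod_insert hi, Finset.prod_insert hi]
    ring

namespace BalancedWeights

variable {ι : Type*} [Fintype ι] [DecidableEq ι]
  {F : Finset (Finset ι)} {n : ℕ} {w : Finset ι → ℂ} {a : Finset ι → ι → ℂ}
  {t : Finset ι → ι → ι → ℂ}

/-- A monomial of degree `d` contributes `z^d` times its localization sum, which is zero unless `d ≥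
n - |K|`. -/
theorem isBigO_eval (h : BalancedWeights F n w a t) (K : Finset ι) (P : MvPolynomial ι ℂ) :
    (fun z : ℂ => ∑ I ∈ F with K ⊆ I,
      w I * MvPolynomial.eval (fun i => z * a I i) P / ∏ i ∈ I \ K, a I i)
      =O[𝓝 0] fun z => z ^ (n - K.card) := by
  have hexp : ∀ z : ℂ, ∑ I ∈ F with K ⊆ I,
      w I * MvPolynomial.eval (fun i => z * a I i) P / ∏ i ∈ I \ K, a I i =
      ∑ e ∈ P.support, P.coeff e * z ^ e.toMultiset.card *
        localizationSum F w a K e.toMultiset := by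
    intro z
    simp_rw [MvPolynomial.eval_eq', localizationSum, Finset.mul_sum, Finset.sum_div]
    rw [Finset.sum_comm]
    refine Finset.sum_congr rfl fun e _ => Finset.sum_congr rfl fun I _ => ?_
    have h1 : (e.toMultiset.map (a I)).prod = ∏ i, a I i ^ e i := by
      rw [Finsupp.toMultiset_map, Finsupp.prod_toMultiset, Finsupp.prod_mapDomain_index
        (fun _ => pow_zero _) (fun _ _ _ => pow_add _ _ _), Finsupp.prod_fintype _ _
        (fun _ => pow_zero _)]
    have h2 : z ^ e.toMultiset.card = ∏ i, z ^ e i := by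
      rw [Finsupp.card_toMultiset, Finsupp.sum_fintype _ _ (fun _ => rfl),
        Finset.prod_pow_eq_pow_sum]
      rfl
    rw [h1, h2]
    simp_rw [mul_pow, Finset.prod_mul_distrib]
    ring
  simp_rw [hexp]
  refine IsBigO.fun_sum fun e _ => ?_
  rcases Nat.lt_or_ge (K.card + e.toMultiset.card) n with hlt | hge
  · rw [h.localizationSum_eq_zero _ K hlt]
    simpa using isBigO_zero _ _
  · have hpow : (fun z : ℂ => z ^ e.toMultiset.card) =O[𝓝 0] fun z => z ^ (n - K.card) := by
      obtain ⟨d, hd⟩ := Nat.exists_eq_add_of_le (Nat.sub_le_iff_le_add'.2 hge)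
      simp_rw [hd, pow_add]
      have : (fun z : ℂ => z ^ d) =O[𝓝 0] fun _ => (1 : ℂ) :=
        (continuous_pow d).continuousAt.isBigO_one ℂ
      simpa using (isBigO_refl (fun z : ℂ => z ^ (n - K.card)) (𝓝 0)).mul this
    refine (hpow.const_mul_left (P.coeff e * localizationSum F w a K e.toMultiset)).congr_left
      fun z => ?_
    ring

/-- Localization sums over the star of `K` of products of analytic functions vanish to the order
`n - |K|`. -/
theorem isBigO_analytic (h : BalancedWeights F n w a t) (K : Finset ι) {f : ι → ℂ → ℂ}
    (hf : ∀ i, AnalyticAt ℂ (f i) 0) :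
    (fun z : ℂ => ∑ I ∈ F with K ⊆ I,
      w I * (∏ i, f i (z * a I i)) / ∏ i ∈ I \ K, a I i)
      =O[𝓝 0] fun z => z ^ (n - K.card) := by
  -- Taylor polynomials reduce the claim to polynomials; the error is already of the required order
  -- at each facet separately.
  choose P hP using fun i => (hf i).exists_polynomial_isBigO (n - K.card)
  have hev := h.isBigO_eval K (∏ i, Polynomial.aeval (MvPolynomial.X i) (P i))
  have hscale : ∀ c : ℂ, Tendsto (fun z : ℂ => z * c) (𝓝 0) (𝓝 0) := fun c => by
    simpa using (continuous_mul_const c).tendsto 0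
  have hsub : (fun z : ℂ => ∑ I ∈ F with K ⊆ I, w I / (∏ i ∈ I \ K, a I i) *
      (∏ i, f i (z * a I i) - ∏ i, (P i).eval (z * a I i)))
      =O[𝓝 0] fun z => z ^ (n - K.card) := by
    refine IsBigO.fun_sum fun I _ => IsBigO.const_mul_left ?_ _
    refine isBigO_prod_sub_prod _ (fun i _ => ?_) (fun i _ => ?_) (fun i _ => ?_)
    · exact ((hf i).continuousAt.isBigO_one ℂ).comp_tendsto (hscale _)
    · exact ((P i).continuous.continuousAt.isBigO_one ℂ).comp_tendsto (hscale _)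
    · refine ((hP i).comp_tendsto (hscale (a I i))).trans ?_
      simp only [Function.comp_def, mul_pow]
      simp_rw [mul_comm _ (a I i ^ _)]
      exact (isBigO_refl _ _).const_mul_left _
  refine (hsub.add hev).congr_left fun z => ?_
  rw [← Finset.sum_add_distrib]
  refine Finset.sum_congr rfl fun I _ => ?_
  have : MvPolynomial.eval (fun i => z * a I i)
      (∏ i, Polynomial.aeval (MvPolynomial.X i) (P i)) = ∏ i, (P i).eval (z * a I i) := by
    rw [map_prod]
    refine Finset.prod_congr rfl fun i _ => ?_
    rw [Polynomial.aeval_def, Polynomial.hom_eval₂, MvPolynomial.eval_X]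
    congr 1
    ext
    simp
  rw [this]
  ring

end BalancedWeights

/-! ### Cones in terms of the edge vectors -/

namespace SimplicialMultiFan

theorem mem_facets {ι : Type*} [Fintype ι] [DecidableEq ι] {L : Type*} [AddCommGroup L]
    {Δ : SimplicialMultiFan ι L} {I : Finset ι} :
    I ∈ Δ.facets ↔ I ∈ Δ.faces ∧ I.card = Module.finrank ℤ L :=
  Finset.mem_filter

namespace EdgeVectors

section Cones

variable {ι : Type*} [Fintype ι] [DecidableEq ι] {L : Type*} [AddCommGroup L]
  {Δ : SimplicialMultiFan ι L}

theorem cone_eq_hull (V : Δ.EdgeVectors) {J : Finset ι} (hJ : J ∈ Δ.faces) :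
    Δ.cone J = PointedCone.hull ℝ ((fun i => latticeIncl L (V.vec i)) '' (J : Set ι)) := by
  obtain ⟨b, -, hb⟩ := Δ.cone_simplicial J hJ
  have hsingle : ∀ j ∈ J, PointedCone.hull ℝ {latticeIncl L (V.vec j)} =
      PointedCone.hull ℝ {latticeIncl L (b j)} := fun j hj => by
    rw [← V.hull_eq j, hb {j} (by simpa using hj)]
    simp
  rw [hb J subset_rfl]
  apply le_antisymm
  · refine Submodule.span_le.2 ?_
    rintro _ ⟨j, hj, rfl⟩
    have h1 : latticeIncl L (b j) ∈ PointedCone.hull ℝ {latticeIncl L (b j)} :=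
      Submodule.subset_span rfl
    rw [← hsingle j hj] at h1
    exact Submodule.span_mono (Set.singleton_subset_iff.2 (Set.mem_image_of_mem _ hj)) h1
  · refine Submodule.span_le.2 ?_
    rintro _ ⟨j, hj, rfl⟩
    have h1 : latticeIncl L (V.vec j) ∈ PointedCone.hull ℝ {latticeIncl L (V.vec j)} :=
      Submodule.subset_span rfl
    rw [hsingle j hj] at h1
    exact Submodule.span_mono (Set.singleton_subset_iff.2 (Set.mem_image_of_mem _ hj)) h1

theorem vec_mem_cone (V : Δ.EdgeVectors) {J : Finset ι} (hJ : J ∈ Δ.faces) {j : ι} (hj : j ∈ J) :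
    latticeIncl L (V.vec j) ∈ Δ.cone J := by
  rw [V.cone_eq_hull hJ]
  exact Submodule.subset_span ⟨j, hj, rfl⟩

theorem vec_mem_coneSpan (V : Δ.EdgeVectors) {J : Finset ι} (hJ : J ∈ Δ.faces) {j : ι}
    (hj : j ∈ J) : latticeIncl L (V.vec j) ∈ Δ.coneSpan J :=
  Submodule.subset_span (V.vec_mem_cone hJ hj)

/-- A linear form vanishing on the edge vectors of a simplex vanishes on the span of its cone. -/
theorem eq_zero_of_mem_coneSpan (V : Δ.EdgeVectors) {J : Finset ι} (hJ : J ∈ Δ.faces)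
    (u : (ℝ ⊗[ℤ] L) →ₗ[ℝ] ℝ) (hu : ∀ j ∈ J, u (latticeIncl L (V.vec j)) = 0) :
    Δ.coneSpan J ≤ LinearMap.ker u := by
  refine Submodule.span_le.2 fun x hx => ?_
  rw [V.cone_eq_hull hJ] at hx
  have : PointedCone.hull ℝ ((fun i => latticeIncl L (V.vec i)) '' (J : Set ι)) ≤
      (LinearMap.ker u).restrictScalars _ := by
    refine Submodule.span_le.2 ?_
    rintro _ ⟨j, hj, rfl⟩
    exact hu j hj
  exact this hx

theorem vec_mem_lat (V : Δ.EdgeVectors) {I : Finset ι} {i : ι} (hi : i ∈ I) :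
    V.vec i ∈ V.lat I :=
  Submodule.subset_span ⟨i, hi, rfl⟩

end Cones

/-! ### Divisibility of `c_1` and powers of `ζ` -/

section Chern

variable {ι : Type*} [Fintype ι] [DecidableEq ι] {L : Type*} [AddCommGroup L]
  {Δ : SimplicialMultiFan ι L}

/-- The coefficient of `x_i`, as a ring homomorphism from the face ring to the dual numbers. -/
theorem exists_faceRing_toDualNumber (Δ : SimplicialMultiFan ι L) (i : ι) :
    ∃ g : Δ.FaceRing →+* DualNumber ℤ,
      ∀ j, g (Δ.xClass j) = if j = i then DualNumber.eps else 0 := by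
  set g₀ : MvPolynomial ι ℤ →+* DualNumber ℤ :=
    (MvPolynomial.aeval fun j => if j = i then (DualNumber.eps : DualNumber ℤ) else 0).toRingHom
    with hg₀
  have hX : ∀ j, g₀ (MvPolynomial.X j) = if j = i then DualNumber.eps else 0 := fun j => by
    simp [hg₀]
  have hker : ∀ p ∈ Δ.faceIdeal, g₀ p = 0 := by
    have : Δ.faceIdeal ≤ RingHom.ker g₀ := by
      refine Ideal.span_le.2 ?_
      rintro _ ⟨J, hJ, rfl⟩
      -- All subsets of `{i}` are simplices, so each generator of the ideal contains a variable sent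
      -- to zero.
      have hsub : ¬ J ⊆ {i} := fun h => hJ (Δ.down_closed _ (Δ.singleton_mem i) _ h)
      obtain ⟨j, hj, hji⟩ := Finset.not_subset.1 hsub
      rw [SetLike.mem_coe, RingHom.mem_ker, map_prod]
      refine Finset.prod_eq_zero hj ?_
      rw [hX, if_neg (by simpa using hji)]
    exact fun p hp => this hp
  exact ⟨Ideal.Quotient.lift _ g₀ hker, fun j => by
    rw [← hX j]; exact Ideal.Quotient.lift_mk _ _ _⟩

/-- If `c_1` is divisible by `N`, some `u ∈ L^*` takes values congruent to `1` modulo `N` on all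
edge vectors. -/
theorem ChernDivisible.exists_dual {V : Δ.EdgeVectors} {N : ℕ} (hc : V.ChernDivisible N) :
    ∃ u : Module.Dual ℤ L, ∀ i, (N : ℤ) ∣ 1 - u (V.vec i) := by
  obtain ⟨y, hy⟩ := hc
  obtain ⟨Y, rfl⟩ := Submodule.mkQ_surjective _ y
  rw [firstChern, ← map_nsmul, ← sub_eq_zero, ← map_sub, Submodule.mkQ_apply,
    Submodule.Quotient.mk_eq_zero] at hy
  obtain ⟨u, hu⟩ := hy
  refine ⟨u, fun i => ?_⟩
  -- In `H_T^2` one has `∑_j u(v_j) x_j = ∑_j x_j - N Y`; the congruence is read off from the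
  -- coefficient of `x_i`.
  obtain ⟨g, hg⟩ := exists_faceRing_toDualNumber Δ i
  have h := congrArg (fun z : Δ.H2T => g z) hu
  simp only [fromH2BT, LinearMap.coe_mk, AddHom.coe_mk, Submodule.coe_sub, Submodule.coe_sum,
    Submodule.coe_smul, map_sum, map_sub, map_zsmul, hg, smul_ite, smul_zero,
    Finset.sum_ite_eq', Finset.mem_univ, if_true] at h
  have hY : g ((N • Y : Δ.H2T) : Δ.FaceRing) = N • g Y := by
    rw [AddSubmonoidClass.coe_nsmul, map_nsmul]
  rw [hY] at h
  have h' := congrArg TrivSqZeroExt.snd h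
  simp only [TrivSqZeroExt.snd_smul, TrivSqZeroExt.snd_sub, DualNumber.snd_eps] at h'
  refine ⟨TrivSqZeroExt.snd (g Y), ?_⟩
  simp only [smul_eq_mul, mul_one, nsmul_eq_mul] at h'
  linarith

/-- If `c_1` is divisible by `N`, the product of the `N`-th roots of unity `ζ^{⟨u_i^I, p⟩}` over
a facet `I` does not depend on `I`. -/
theorem prod_zpow_coordinates (V : Δ.EdgeVectors) {N : ℕ} {u : Module.Dual ℤ L}
    (hu : ∀ i, (N : ℤ) ∣ 1 - u (V.vec i)) {ζ : ℂ} (hN : N ≠ 0) (hζ : ζ ^ N = 1) {I : Finset ι}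
    {p : L} {n : ι → ℤ} (hp : p = ∑ i ∈ I, n i • V.vec i) : ∏ i ∈ I, ζ ^ n i = ζ ^ u p := by
  have hζ0 : ζ ≠ 0 := fun h => by simp [h, hN] at hζ
  -- The difference is `∑ n_i (1 - u(v_i))`.
  have hdvd : (N : ℤ) ∣ (∑ i ∈ I, n i) - u p := by
    rw [hp, map_sum, ← Finset.sum_sub_distrib]
    refine Finset.dvd_sum fun i _ => ?_
    rw [map_smul, smul_eq_mul, ← mul_one_sub]
    exact (hu i).mul_left _
  obtain ⟨k, hk⟩ := hdvd
  have hprod : ∀ s : Finset ι, ∏ i ∈ s, ζ ^ n i = ζ ^ ∑ i ∈ s, n i := fun s => by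
    induction s using Finset.induction_on with
    | empty => simp
    | insert i s hi ih => rw [Finset.prod_insert hi, Finset.sum_insert hi, zpow_add₀ hζ0, ih]
  rw [hprod, eq_add_of_sub_eq hk, zpow_add₀ hζ0, zpow_mul, zpow_natCast, hζ, one_zpow, one_mul]

end Chern

/-! ### Dual bases and the balancing condition -/

section Dual

variable {ι : Type*} [Fintype ι] [DecidableEq ι] {L : Type*} [AddCommGroup L]
  [Module.Free ℤ L] [Module.Finite ℤ L] {Δ : SimplicialMultiFan ι L}

/-- The form `u_i^I`, extended by zero to all `I` and `i`. -/
def dual (V : Δ.EdgeVectors) (I : Finset ι) (i : ι) : (ℝ ⊗[ℤ] L) →ₗ[ℝ] ℝ :=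
  if h : I ∈ Δ.facets ∧ i ∈ I then (V.facetBasis ⟨I, h.1⟩).coord ⟨i, h.2⟩ else 0

theorem pairing_eq_dual (V : Δ.EdgeVectors) (I : Δ.facets) (i : I.1) (x : L) :
    V.pairing I i x = V.dual I.1 i (latticeIncl L x) := by
  rw [pairing, dual, dif_pos ⟨I.2, i.2⟩]

theorem dual_eq_zero (V : Δ.EdgeVectors) {I : Finset ι} {i : ι} (hi : i ∉ I) :
    V.dual I i = 0 :=
  dif_neg fun h => hi h.2

theorem dual_vec (V : Δ.EdgeVectors) {I : Finset ι} (hI : I ∈ Δ.facets) {i j : ι} (hi : i ∈ I)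
    (hj : j ∈ I) : V.dual I i (latticeIncl L (V.vec j)) = if j = i then 1 else 0 := by
  have hb : V.facetBasis ⟨I, hI⟩ ⟨j, hj⟩ = latticeIncl L (V.vec j) :=
    Module.Basis.mk_apply _ _ _
  rw [dual, dif_pos ⟨hI, hi⟩, ← hb, Module.Basis.coord_apply, Module.Basis.repr_self,
    Finsupp.single_apply]
  simp only [Subtype.mk.injEq]

theorem sum_dual_smul (V : Δ.EdgeVectors) {I : Finset ι} (hI : I ∈ Δ.facets) (x : ℝ ⊗[ℤ] L) :
    ∑ i ∈ I, V.dual I i x • latticeIncl L (V.vec i) = x := by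
  conv_rhs => rw [← (V.facetBasis ⟨I, hI⟩).sum_repr x]
  rw [← Finset.sum_coe_sort]
  refine Finset.sum_congr rfl fun i _ => ?_
  have hb : V.facetBasis ⟨I, hI⟩ i = latticeIncl L (V.vec i) :=
    Module.Basis.mk_apply _ _ _
  rw [hb, dual, dif_pos ⟨hI, i.2⟩, Module.Basis.coord_apply]

theorem apply_eq_sum_dual (V : Δ.EdgeVectors) {I : Finset ι} (hI : I ∈ Δ.facets)
    (u : (ℝ ⊗[ℤ] L) →ₗ[ℝ] ℝ) (x : ℝ ⊗[ℤ] L) :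
    u x = ∑ i ∈ I, u (latticeIncl L (V.vec i)) * V.dual I i x := by
  conv_lhs => rw [← V.sum_dual_smul hI x]
  simp [mul_comm]

theorem exists_dual_eq_intCast (V : Δ.EdgeVectors) {I : Finset ι} (hI : I ∈ Δ.facets) (i : ι)
    {p : L} (hp : p ∈ V.lat I) : ∃ m : ℤ, V.dual I i (latticeIncl L p) = m := by
  by_cases hi : i ∈ I
  · induction hp using Submodule.span_induction with
    | mem x hx =>
      obtain ⟨j, hj, rfl⟩ := hx
      rw [V.dual_vec hI hi hj]
      split_ifs
      exacts [⟨1, by simp⟩, ⟨0, by simp⟩]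
    | zero => exact ⟨0, by simp⟩
    | add x y _ _ hx hy =>
      obtain ⟨m, hm⟩ := hx
      obtain ⟨k, hk⟩ := hy
      exact ⟨m + k, by rw [map_add, map_add, hm, hk]; push_cast; rfl⟩
    | smul c x _ hx =>
      obtain ⟨m, hm⟩ := hx
      exact ⟨c * m, by rw [map_smul, map_zsmul, hm]; simp⟩
  · exact ⟨0, by simp [V.dual_eq_zero hi]⟩

theorem dual_ne_zero_of_isGeneric (V : Δ.EdgeVectors) {x : ℝ ⊗[ℤ] L} (hx : Δ.IsGeneric x)
    {I : Finset ι} (hI : I ∈ Δ.facets) {i : ι} (hi : i ∈ I) : V.dual I i x ≠ 0 := by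
  intro h0
  obtain ⟨hIf, hIc⟩ := mem_facets.1 hI
  have hJ : I.erase i ∈ Δ.faces := Δ.down_closed I hIf _ (Finset.erase_subset _ _)
  refine hx (I.erase i) hJ (by rw [← hIc]; exact Finset.card_erase_lt_of_mem hi) ?_
  rw [← V.sum_dual_smul hI x, ← Finset.add_sum_erase _ _ hi, h0, zero_smul, zero_add]
  exact Submodule.sum_mem _ fun j hj => Submodule.smul_mem _ _ (V.vec_mem_coneSpan hJ hj)

theorem dual_nonneg_of_mem_cone (V : Δ.EdgeVectors) {J : Finset ι} (hJ : J ∈ Δ.facets) {j : ι}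
    (hj : j ∈ J) {y : ℝ ⊗[ℤ] L} (hy : y ∈ Δ.cone J) : 0 ≤ V.dual J j y := by
  rw [V.cone_eq_hull (mem_facets.1 hJ).1] at hy
  induction hy using Submodule.span_induction with
  | mem x hx =>
    obtain ⟨k, hk, rfl⟩ := hx
    simp only [V.dual_vec hJ hj hk]
    split_ifs <;> simp
  | zero => simp
  | add x y _ _ hx hy => rw [map_add]; exact add_nonneg hx hy
  | smul c x _ hx =>
    rw [← Nonneg.coe_smul, map_smul, smul_eq_mul]
    exact mul_nonneg c.2 hx

/-- In a complete multi-fan of global type the weights are balanced around each simplex of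
codimension one. -/
theorem sum_weight_mul_dual_eq_zero (V : Δ.EdgeVectors) (hΔ : Δ.IsComplete) (hP : V.GlobalType)
    {I : Finset ι} (hI : I ∈ Δ.facets) {i : ι} (hi : i ∈ I) :
    ∑ J ∈ Δ.facets with I.erase i ⊆ J,
      (Δ.w J : ℝ) * ∑ j ∈ J \ I.erase i, V.dual I i (latticeIncl L (V.vec j)) = 0 := by
  classical
  obtain ⟨hIf, hIc⟩ := mem_facets.1 hI
  set K := I.erase i with hKdef
  have hKI : K ⊆ I := Finset.erase_subset _ _
  have hK : K ∈ Δ.faces := Δ.down_closed I hIf _ hKI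
  have hKc : K.card + 1 = Module.finrank ℤ L := by
    rw [← hIc]; exact Finset.card_erase_add_one hi
  have hvan : ∀ k ∈ K, V.dual I i (latticeIncl L (V.vec k)) = 0 := fun k hk => by
    rw [V.dual_vec hI hi (hKI hk), if_neg (Finset.ne_of_mem_erase hk)]
  have hker := V.eq_zero_of_mem_coneSpan hK (V.dual I i) hvan
  set e : (ℝ ⊗[ℤ] L) ⧸ Δ.coneSpan K := (Δ.coneSpan K).mkQ (latticeIncl L (V.vec i)) with he
  set φ := (Δ.coneSpan K).liftQ (V.dual I i) hker with hφ
  have hφe : φ e = 1 := by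
    rw [he, hφ, Submodule.mkQ_apply, Submodule.liftQ_apply, V.dual_vec hI hi hi, if_pos rfl]
  -- As `|K| = n - 1`, the only simplex tested by genericity is `K` itself, whose projected cone is
  -- zero.
  have hgen : ∀ x, φ x ≠ 0 → Δ.IsProjGeneric K x := by
    intro x hx J _ hKJ hJc hmem
    have hJK : J = K := (Finset.eq_of_subset_of_card_le hKJ (by omega)).symm
    subst hJK
    have hle : Submodule.span ℝ
        (Δ.projCone K K : Set ((ℝ ⊗[ℤ] L) ⧸ Δ.coneSpan K)) ≤ ⊥ := by
      refine Submodule.span_le.2 ?_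
      rintro _ ⟨y, hy, rfl⟩
      exact (Submodule.Quotient.mk_eq_zero _).2 (Submodule.subset_span hy)
    rw [(Submodule.mem_bot ℝ).1 (hle hmem), map_zero] at hx
    exact hx rfl
  -- `e` and `-e` lie on the two half-lines of the one-dimensional quotient; equality of the degrees
  -- there is the balancing, once each coefficient `⟨u_i^I, v_j⟩` is known to be `±1`.
  have hdeg := hΔ K hK e (-e) (hgen e (by simp [hφe])) (hgen (-e) (by simp [hφe]))
  rw [projDegreeAt, projDegreeAt, Finset.filter_and, Finset.filter_and,
    ← Finset.filter_mem_eq_inter, ← Finset.filter_mem_eq_inter] at hdeg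
  have hterm : ∀ J ∈ Δ.facets.filter (K ⊆ ·),
      (Δ.w J : ℝ) * ∑ j ∈ J \ K, V.dual I i (latticeIncl L (V.vec j)) =
        ((if e ∈ Δ.projCone K J then Δ.w J else 0 : ℤ) : ℝ) -
          ((if -e ∈ Δ.projCone K J then Δ.w J else 0 : ℤ) : ℝ) := by
    intro J hJ
    obtain ⟨hJF, hKJ⟩ := Finset.mem_filter.1 hJ
    obtain ⟨hJf, hJc⟩ := mem_facets.1 hJF
    have hcard : (J \ K).card = 1 := by
      have := Finset.card_sdiff_add_card_eq_card hKJ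
      omega
    obtain ⟨j, hjK⟩ := Finset.card_eq_one.1 hcard
    obtain ⟨hj, hj'⟩ := Finset.mem_sdiff.1 (hjK ▸ Finset.mem_singleton_self j : j ∈ J \ K)
    have hJK : ∀ k ∈ J, k ≠ j → k ∈ K := fun k hk hkj => by
      by_contra hkK
      exact hkj (Finset.mem_singleton.1 (hjK ▸ Finset.mem_sdiff.2 ⟨hk, hkK⟩))
    rw [hjK, Finset.sum_singleton]
    -- Both `u_i^I` and `u_j^J` vanish on `K`, hence they are proportional.
    have hproj : ∀ y, V.dual I i y = V.dual I i (latticeIncl L (V.vec j)) * V.dual J j y := by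
      intro y
      rw [V.apply_eq_sum_dual hJF (V.dual I i) y, Finset.sum_eq_single j]
      · exact fun k hk hkj => by rw [hvan k (hJK k hk hkj), zero_mul]
      · exact fun h => absurd hj h
    set s := V.dual I i (latticeIncl L (V.vec j)) with hs
    have hlat : V.lat I = V.lat J := (hP I hI).trans (hP J hJF).symm
    have hπ : (Δ.coneSpan K).mkQ (latticeIncl L (V.vec j)) = s • e := by
      rw [he, ← map_smul, ← sub_eq_zero, ← map_sub, Submodule.mkQ_apply,
        Submodule.Quotient.mk_eq_zero]
      have hx := V.sum_dual_smul hI (latticeIncl L (V.vec j))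
      rw [← Finset.add_sum_erase _ _ hi, ← hs] at hx
      rw [← hx, add_sub_cancel_left]
      exact Submodule.sum_mem _ fun k hk => Submodule.smul_mem _ _ (V.vec_mem_coneSpan hK hk)
    have hmem : s • e ∈ Δ.projCone K J := ⟨_, V.vec_mem_cone hJf hj, hπ⟩
    have hsign : ∀ x ∈ Δ.projCone K J, ∃ c : ℝ, 0 ≤ c ∧ φ x = s * c := by
      rintro _ ⟨y, hy, rfl⟩
      exact ⟨V.dual J j y, V.dual_nonneg_of_mem_cone hJF hj hy, hproj y⟩
    -- By (P) the edge vectors of `I` and of `J` generate the same lattice, so `s` is an integer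
    -- with an integer inverse.
    have hunit : s = 1 ∨ s = -1 := by
      obtain ⟨m, hm⟩ := V.exists_dual_eq_intCast hI i (hlat ▸ V.vec_mem_lat hj)
      obtain ⟨k, hk⟩ := V.exists_dual_eq_intCast hJF j (hlat ▸ V.vec_mem_lat hi)
      have h1 := hproj (latticeIncl L (V.vec i))
      rw [V.dual_vec hI hi hi, if_pos rfl, hk, hs, hm] at h1
      have h2 : m * k = 1 := by exact_mod_cast h1.symm
      rw [hs, hm]
      rcases Int.eq_one_or_neg_one_of_mul_eq_one h2 with h | h <;> simp [h]
    rcases hunit with h | h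
    · rw [h, one_smul] at hmem
      have hneg : -e ∉ Δ.projCone K J := fun hx => by
        obtain ⟨c, hc, hce⟩ := hsign _ hx
        rw [map_neg, hφe, h] at hce
        linarith
      rw [if_pos hmem, if_neg hneg, h]
      simp
    · rw [h, neg_one_smul] at hmem
      have hneg : e ∉ Δ.projCone K J := fun hx => by
        obtain ⟨c, hc, hce⟩ := hsign _ hx
        rw [hφe, h] at hce
        linarith
      rw [if_pos hmem, if_neg hneg, h]
      simp
  rw [Finset.sum_congr rfl hterm, Finset.sum_sub_distrib, ← Int.cast_sum, ← Int.cast_sum,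
    sub_eq_zero, Int.cast_inj, ← Finset.sum_filter, ← Finset.sum_filter]
  convert hdeg using 2 <;> · ext; simp; tauto

/-- The weights of a complete multi-fan of global type, with the values of the dual bases at a
generic vector. -/
theorem balancedWeights (V : Δ.EdgeVectors) (hΔ : Δ.IsComplete) (hP : V.GlobalType)
    {x : ℝ ⊗[ℤ] L} (hx : Δ.IsGeneric x) :
    BalancedWeights Δ.facets (Module.finrank ℤ L) (fun I => (Δ.w I : ℂ))
      (fun I i => (V.dual I i x : ℂ))
      (fun I i j => (V.dual I i (latticeIncl L (V.vec j)) : ℂ)) where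
  card_eq I hI := (mem_facets.1 hI).2
  ne_zero I hI i hi := Complex.ofReal_ne_zero.2 (V.dual_ne_zero_of_isGeneric hx hI hi)
  eq_zero I _ i hi := by simp [V.dual_eq_zero hi]
  dual_self I hI i hi := by simp [V.dual_vec hI hi hi]
  dual_ne I hI i hi j hj hji := by simp [V.dual_vec hI hi hj, hji]
  expand I _ i _ J hJ := by
    rw [V.apply_eq_sum_dual hJ (V.dual I i) x]
    push_cast
    rfl
  balanced I hI i hi := by
    have := congrArg (fun r : ℝ => (r : ℂ)) (V.sum_weight_mul_dual_eq_zero hΔ hP hI hi)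
    simpa using this

end Dual

end EdgeVectors

end SimplicialMultiFan

/-! ### Doubly periodic functions without poles -/

theorem UpperHalfPlane.exists_eq_add_mul (τ : UpperHalfPlane) (z : ℂ) :
    ∃ x y : ℝ, z = x + y * τ := by
  have him : (τ : ℂ).im ≠ 0 := τ.im_ne_zero
  refine ⟨z.re - z.im / (τ : ℂ).im * (τ : ℂ).re, z.im / (τ : ℂ).im, ?_⟩
  apply Complex.ext
  · simp
  · simp only [Complex.add_im, Complex.ofReal_im, Complex.mul_im, Complex.ofReal_re, zero_mul,
      add_zero, zero_add]
    field_simp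

theorem UpperHalfPlane.eq_of_add_mul_eq (τ : UpperHalfPlane) {x y x' y' : ℝ}
    (h : (x + y * τ : ℂ) = x' + y' * τ) : x = x' ∧ y = y' := by
  have him : (τ : ℂ).im ≠ 0 := τ.im_ne_zero
  have hy : y = y' := by
    have := congrArg Complex.im h
    simp only [Complex.add_im, Complex.ofReal_im, Complex.mul_im, Complex.ofReal_re, zero_mul,
      add_zero, zero_add] at this
    exact mul_right_cancel₀ him this
  subst hy
  exact ⟨by exact_mod_cast add_right_cancel h, rfl⟩

/-- A function bounded near every point, differentiable off a discrete closed set, whose absolute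
value has periods `1` and `τ`, is constant where it is differentiable. -/
theorem exists_eq_const_of_doublyPeriodic_norm (τ : UpperHalfPlane) {G : ℂ → ℂ} {R : Set ℂ}
    (hR : R ∈ codiscrete ℂ) (hd : ∀ z ∈ R, DifferentiableAt ℂ G z)
    (hb : ∀ z, G =O[𝓝[≠] z] fun _ => (1 : ℂ))
    (h1 : ∀ z, ‖G (z + 1)‖ = ‖G z‖) (hτ : ∀ z, ‖G (z + τ)‖ = ‖G z‖) :
    ∃ c : ℂ, ∀ z ∈ R, G z = c := by
  have hR' : ∀ z, ∀ᶠ y in 𝓝[≠] z, y ∈ R := fun z => by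
    have := (mem_codiscrete.1 hR) z
    rwa [disjoint_principal_right, compl_compl] at this
  set H : ℂ → ℂ := fun z => limUnder (𝓝[≠] z) G with hH
  have hHR : ∀ z ∈ R, H z = G z := fun z hz =>
    ((hd z hz).continuousAt.tendsto.mono_left nhdsWithin_le_nhds).limUnder_eq
  -- Riemann's removable singularity theorem at each point.
  have hHd : Differentiable ℂ H := fun z => by
    obtain ⟨C, hC⟩ := (hb z).bound
    have hs : insert z (R ∩ {y | ‖G y‖ ≤ C}) ∈ 𝓝 z := by
      refine insert_mem_nhds_iff.2 (inter_mem (hR' z) ?_)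
      filter_upwards [hC] with y hy
      simpa using hy
    have hu := Complex.differentiableOn_update_limUnder_of_bddAbove (f := G) hs
      (fun y hy => (hd y (hy.1.resolve_left hy.2).1).differentiableWithinAt) (by
        refine ⟨C, ?_⟩
        rintro _ ⟨y, hy, rfl⟩
        exact (hy.1.resolve_left hy.2).2)
    refine ((hu.differentiableAt hs).congr_of_eventuallyEq ?_)
    filter_upwards [hs] with y hy
    by_cases hyz : y = z
    · subst hyz; simp [hH]
    · rw [Function.update_of_ne hyz, hHR y (hy.resolve_left hyz).1]
  have hper : ∀ c : ℂ, (∀ z, ‖G (z + c)‖ = ‖G z‖) → Function.Periodic (fun z => ‖H z‖) c := by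
    intro c hc z
    have ht : Tendsto (fun y => y + c) (𝓝[≠] z) (𝓝[≠] (z + c)) := by
      refine tendsto_nhdsWithin_iff.2 ⟨?_, ?_⟩
      · exact ((continuous_add_const c).tendsto z).mono_left nhdsWithin_le_nhds
      · filter_upwards [self_mem_nhdsWithin] with y hy
        simpa using hy
    have e1 : Tendsto (fun y => ‖H (y + c)‖) (𝓝[≠] z) (𝓝 ‖H (z + c)‖) :=
      ((hHd.continuous.comp (continuous_add_const c)).norm.tendsto z).mono_left
        nhdsWithin_le_nhds
    have e2 : Tendsto (fun y => ‖H y‖) (𝓝[≠] z) (𝓝 ‖H z‖) :=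
      (hHd.continuous.norm.tendsto z).mono_left nhdsWithin_le_nhds
    refine tendsto_nhds_unique e1 (e2.congr' ?_)
    filter_upwards [hR' z, ht.eventually (hR' (z + c))] with y hy hyc
    rw [hHR y hy, hHR _ hyc, hc]
  -- By periodicity `|H|` takes all its values at points `x + yτ` with `0 ≤ x, y < 1`, which lie in
  -- the ball of radius `1 + |τ|`.
  have hbdd : Bornology.IsBounded (Set.range H) := by
    obtain ⟨C, hC⟩ := (isCompact_closedBall (0 : ℂ) (1 + ‖(τ : ℂ)‖)).exists_bound_of_continuousOn
      hHd.continuous.continuousOn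
    refine isBounded_iff_forall_norm_le.2 ⟨C, ?_⟩
    rintro _ ⟨z, rfl⟩
    obtain ⟨x, y, rfl⟩ := τ.exists_eq_add_mul z
    have hx := (hper 1 h1).int_mul ⌊x⌋ (Int.fract x + y * τ)
    have hy := (hper τ hτ).int_mul ⌊y⌋ (Int.fract x + Int.fract y * τ)
    have ex : (Int.fract x + y * τ + ⌊x⌋ * 1 : ℂ) = x + y * τ := by
      have : (x : ℂ) = Int.fract x + ⌊x⌋ := by exact_mod_cast (Int.fract_add_floor x).symm
      linear_combination -this
    have ey : (Int.fract x + Int.fract y * τ + ⌊y⌋ * τ : ℂ) = Int.fract x + y * τ := by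
      have : (y : ℂ) = Int.fract y + ⌊y⌋ := by exact_mod_cast (Int.fract_add_floor y).symm
      linear_combination -τ * this
    simp only [ex] at hx
    simp only [ey] at hy
    rw [hx, hy]
    refine hC _ (mem_closedBall_zero_iff.2 ((norm_add_le _ _).trans (add_le_add ?_ ?_)))
    · rw [Complex.norm_real, Real.norm_of_nonneg (Int.fract_nonneg x)]
      exact (Int.fract_lt_one x).le
    · rw [norm_mul, Complex.norm_real, Real.norm_of_nonneg (Int.fract_nonneg y)]
      exact mul_le_of_le_one_left (norm_nonneg _) (Int.fract_lt_one y).le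
  obtain ⟨c, hc⟩ := hHd.exists_eq_const_of_bounded hbdd
  exact ⟨c, fun z hz => by rw [← hHR z hz, hc]; rfl⟩

/-! ### Local behaviour of `ϕ` -/

/-- A root of unity has `|ζ| = 1`, so `σ` is real; a real lattice point is an integer, which would
give `ζ = 1`. Hence `Φ(σ,τ) ≠ 0`. -/
theorem ne_int_add_int_mul_of_pow_eq_one {σ : ℂ} {N : ℕ} (hN : N ≠ 0)
    (hσ : Complex.exp (2 * Real.pi * Complex.I * σ) ^ N = 1)
    (hσ' : Complex.exp (2 * Real.pi * Complex.I * σ) ≠ 1) (τ : UpperHalfPlane) (m n : ℤ) :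
    σ ≠ m + n * τ := by
  intro h
  apply hσ'
  have hnorm := Complex.norm_eq_one_of_pow_eq_one hσ hN
  rw [Complex.norm_exp, Real.exp_eq_one_iff] at hnorm
  have him : σ.im = 0 := by
    have : -(2 * Real.pi) * σ.im = 0 := by
      rw [← hnorm]; simp
    exact (mul_eq_zero.1 this).resolve_left (by simp [Real.pi_ne_zero])
  have hn : (n : ℝ) = 0 := by
    rw [h] at him
    simpa [τ.im_ne_zero] using him
  rw [h, show n = 0 by exact_mod_cast hn]
  refine Complex.exp_eq_one_iff.2 ⟨m, ?_⟩
  push_cast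
  ring

theorem analyticAt_ellipticQuot {c : ℂ} {τ : UpperHalfPlane} (hc : ∀ m n : ℤ, c ≠ m + n * τ)
    (σ : ℂ) : AnalyticAt ℂ (fun z => ellipticQuot (c - z) τ σ) 0 := by
  have hd := differentiable_ellipticPhi τ
  have h1 : Differentiable ℂ fun z => ellipticPhi (c - z + σ) τ :=
    hd.comp (g := fun z => ellipticPhi z τ) (by fun_prop)
  have h2 : Differentiable ℂ fun z => ellipticPhi (c - z) τ :=
    hd.comp (g := fun z => ellipticPhi z τ) (by fun_prop)
  exact (h1.analyticAt 0).div (h2.analyticAt 0) (by simpa using ellipticPhi_ne_zero hc)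

/-- `ϕ` has a simple pole at the origin. -/
theorem exists_ellipticQuot_neg_eq {σ : ℂ} {τ : UpperHalfPlane}
    (hσ : ∀ m n : ℤ, σ ≠ m + n * τ) :
    ∃ (c : ℂ) (g : ℂ → ℂ), AnalyticAt ℂ g 0 ∧ g 0 = 1 ∧
      ∀ z ≠ 0, ellipticQuot (-z) τ σ = c * g z / z := by
  have hd := differentiable_ellipticPhi τ
  set Ψ := dslope (fun z => ellipticPhi z τ) 0 with hΨ
  have hΨd : Differentiable ℂ Ψ := by
    rw [← differentiableOn_univ, hΨ, Complex.differentiableOn_dslope univ_mem]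
    exact hd.differentiableOn
  have hΨ0 : Ψ 0 ≠ 0 := by
    rw [hΨ, dslope_same]
    exact deriv_ellipticPhi_zero_ne_zero τ
  have hΦ : ∀ z, ellipticPhi z τ = z * Ψ z := fun z => by
    have := sub_smul_dslope (fun z => ellipticPhi z τ) 0 z
    simpa [ellipticPhi_zero] using this.symm
  have hσ0 := ellipticPhi_ne_zero hσ
  -- From `Φ(z) = z Ψ(z)`; the leading coefficient is split off so that `g 0 = 1`.
  refine ⟨-(ellipticPhi σ τ / Ψ 0),
    fun z => ellipticPhi (-z + σ) τ / Ψ (-z) / (ellipticPhi σ τ / Ψ 0), ?_, ?_, ?_⟩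
  · have h1 : Differentiable ℂ fun z => ellipticPhi (-z + σ) τ :=
      hd.comp (g := fun z => ellipticPhi z τ) (by fun_prop)
    have h2 : Differentiable ℂ fun z => Ψ (-z) := hΨd.comp (by fun_prop)
    exact ((h1.analyticAt 0).div (h2.analyticAt 0) (by simpa using hΨ0)).div analyticAt_const
      (div_ne_zero hσ0 hΨ0)
  · simp only [neg_zero, zero_add]
    exact div_self (div_ne_zero hσ0 hΨ0)
  · intro z hz
    beta_reduce
    rw [ellipticQuot, hΦ (-z), neg_mul, neg_mul, mul_div_cancel₀ _ (div_ne_zero hσ0 hΨ0), div_neg,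
      mul_comm z, ← div_div, neg_div]

namespace SimplicialMultiFan.EdgeVectors

variable {ι : Type*} [Fintype ι] [DecidableEq ι] {L : Type*} [AddCommGroup L]
  [Module.Free ℤ L] [Module.Finite ℤ L] {Δ : SimplicialMultiFan ι L}

/-! ### Coordinates of lattice vectors -/

theorem exists_int_coordinates (V : Δ.EdgeVectors) {I : Finset ι} (hI : I ∈ Δ.facets) {p : L}
    (hp : p ∈ V.lat I) : ∃ n : ι → ℤ, (∀ i ∈ I, V.dual I i (latticeIncl L p) = n i) ∧
      p = ∑ i ∈ I, n i • V.vec i := by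
  obtain ⟨k, hk⟩ := (Submodule.mem_span_image_finset_iff_exists_fun ℤ).1 hp
  obtain ⟨n, hn⟩ : ∃ n : ι → ℤ, p = ∑ i ∈ I, n i • V.vec i :=
    ⟨fun i => if h : i ∈ I then k ⟨i, h⟩ else 0, by
      rw [← hk]
      refine Eq.trans (Finset.sum_congr rfl fun i _ => ?_) (Finset.sum_coe_sort I _)
      simp only [dif_pos i.2]⟩
  refine ⟨n, fun i hi => ?_, hn⟩
  rw [hn, map_sum, map_sum, Finset.sum_eq_single i]
  · rw [map_smul, map_zsmul, V.dual_vec hI hi hi, if_pos rfl]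
    simp
  · intro j hj hji
    rw [map_smul, map_zsmul, V.dual_vec hI hi hj, if_neg hji, smul_zero]
  · exact fun h => absurd hi h

/-- If the coordinates of `X` outside `K` are integers in one facet containing `K`, then
in all facets containing `K` they differ from those of a lattice vector only at `K`, by the same
amounts. -/
theorem exists_dual_eq_add (V : Δ.EdgeVectors) (hP : V.GlobalType) {I₀ : Finset ι}
    (hI₀ : I₀ ∈ Δ.facets) {K : Finset ι} (hK : K ⊆ I₀) (X : ℝ ⊗[ℤ] L)
    (hX : ∀ i ∈ I₀ \ K, ∃ m : ℤ, V.dual I₀ i X = m) :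
    ∃ p ∈ V.latInf, ∀ I ∈ Δ.facets, K ⊆ I → ∀ i ∈ I,
      V.dual I i X = (if i ∈ K then V.dual I₀ i X else 0) + V.dual I i (latticeIncl L p) := by
  choose! m hm using hX
  -- `X - p` is a combination of the `v_j`, `j ∈ K`, and the dual basis of any facet containing `K`
  -- reads off the same coefficients.
  refine ⟨∑ i ∈ I₀ \ K, m i • V.vec i, ?_, fun I hI hKI i hi => ?_⟩
  · rw [← hP I₀ hI₀]
    exact Submodule.sum_mem _ fun i hi => Submodule.smul_mem _ _
      (V.vec_mem_lat (Finset.mem_sdiff.1 hi).1)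
  · have hp : latticeIncl L (∑ i ∈ I₀ \ K, m i • V.vec i) =
        ∑ i ∈ I₀ \ K, V.dual I₀ i X • latticeIncl L (V.vec i) := by
      rw [map_sum]
      refine Finset.sum_congr rfl fun j hj => ?_
      rw [map_smul, hm j hj, Int.cast_smul_eq_zsmul]
    have hdec := V.sum_dual_smul hI₀ X
    rw [← Finset.sum_sdiff hK, ← hp] at hdec
    conv_lhs => rw [← hdec]
    rw [map_add, add_comm, map_sum]
    congr 1
    rw [← Finset.sum_ite_eq K i fun j => V.dual I₀ j X]
    refine Finset.sum_congr rfl fun j hj => ?_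
    rw [map_smul, V.dual_vec hI hi (hKI hj), smul_eq_mul, mul_ite, mul_one, mul_zero]
    simp only [eq_comm]

/-! ### The summands of the elliptic genus -/

/-- The sum `∑_I w(I) ∏_{i ∈ I} ϕ(⟨u_i^I, -zv - l⟩, τ, σ)` for a lattice vector `l`. -/
def genusTerm (V : Δ.EdgeVectors) (v l : L) (τ : UpperHalfPlane) (σ z : ℂ) : ℂ :=
  ∑ I ∈ Δ.facets, (Δ.w I : ℂ) * ∏ i ∈ I,
    ellipticQuot (-(z * V.dual I i (latticeIncl L v)) - V.dual I i (latticeIncl L l)) τ σ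

/-- By (P) the groups `H_I` are one group. Representatives chosen for `I₀` serve for all `I`,
because changing a representative shifts the arguments of `ϕ` by integers; the two sums can then be
exchanged. -/
theorem exists_ellipticGenus_eq_sum_genusTerm (V : Δ.EdgeVectors) (hP : V.GlobalType) (v : L)
    (τ : UpperHalfPlane) (σ : ℂ) : ∃ (κ : ℂ) (s : Finset L), ∀ z,
      V.ellipticGenus v z τ σ = κ * ∑ l ∈ s, V.genusTerm v l τ σ z := by
  classical
  obtain ⟨I₀⟩ : Nonempty Δ.facets := by
    obtain ⟨I, hI, hIc⟩ := Δ.exists_facet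
    exact ⟨⟨I, mem_facets.2 ⟨hI, hIc⟩⟩⟩
  have hout : Function.Injective (Quotient.out : V.quot I₀ → L) := Quotient.out_injective
  refine ⟨(Fintype.card (V.quot I₀) : ℂ)⁻¹, Finset.univ.map ⟨fun h : V.quot I₀ => Quotient.out h, hout⟩, fun z => ?_⟩
  simp_rw [genusTerm, Finset.sum_map, Function.Embedding.coeFn_mk]
  rw [Finset.sum_comm, ellipticGenus, Finset.mul_sum, ← Finset.sum_coe_sort Δ.facets]
  refine Finset.sum_congr rfl fun I _ => ?_
  have hlat : V.lat I.1 = V.lat I₀.1 := (hP I.1 I.2).trans (hP I₀.1 I₀.2).symm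
  let ε : V.quot I ≃ₗ[ℤ] V.quot I₀ := Submodule.quotEquivOfEq _ _ hlat
  rw [Fintype.card_congr ε.toEquiv, ← Finset.mul_sum, ← mul_assoc, div_eq_mul_inv,
    mul_comm (Δ.w I.1 : ℂ)]
  congr 1
  rw [← Equiv.sum_comp ε.toEquiv]
  refine Finset.sum_congr rfl fun h _ => ?_
  refine Eq.trans (Finset.prod_congr rfl fun i _ => ?_) (Finset.prod_coe_sort I.1 _)
  have hmem : (Quotient.out (ε h) : L) - Quotient.out h ∈ V.lat I.1 := by
    have h1 : (Submodule.Quotient.mk (Quotient.out (ε h)) : L ⧸ V.lat I₀.1) = ε h :=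
      Quotient.out_eq _
    have h2 : (Submodule.Quotient.mk (Quotient.out h) : L ⧸ V.lat I.1) = h := Quotient.out_eq _
    have h3 : ε h = Submodule.Quotient.mk (Quotient.out h) := (congrArg ε h2).symm
    exact hlat.symm.le ((Submodule.Quotient.eq _).1 (h1.trans h3))
  obtain ⟨m, hm⟩ := V.exists_dual_eq_intCast I.2 i hmem
  rw [map_sub, map_sub, sub_eq_iff_eq_add] at hm
  rw [genusArg, V.pairing_eq_dual, V.pairing_eq_dual, LinearEquiv.coe_toEquiv, hm,
    ← ellipticQuot_add_int _ τ σ (-m)]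
  · congr 1
    push_cast
    ring

theorem genusTerm_add_one (V : Δ.EdgeVectors) (hP : V.GlobalType) {v : L} (hv : v ∈ V.latInf)
    (l : L) (τ : UpperHalfPlane) (σ z : ℂ) :
    V.genusTerm v l τ σ (z + 1) = V.genusTerm v l τ σ z := by
  refine Finset.sum_congr rfl fun I hI => ?_
  congr 1
  refine Finset.prod_congr rfl fun i _ => ?_
  obtain ⟨m, hm⟩ := V.exists_dual_eq_intCast hI i (p := v) (by rwa [hP I hI])
  rw [hm, ← ellipticQuot_add_int _ τ σ m]
  congr 1
  push_cast
  ring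

/-- Each facet gets the multiplier `∏ ζ^{⟨u_i^I, v⟩}`, and divisibility of `c_1` makes it the same
for all facets. -/
theorem genusTerm_add_tau (V : Δ.EdgeVectors) (hP : V.GlobalType) {N : ℕ} (hN : N ≠ 0)
    {u : Module.Dual ℤ L} (hu : ∀ i, (N : ℤ) ∣ 1 - u (V.vec i)) {v : L} (hv : v ∈ V.latInf)
    (l : L) (τ : UpperHalfPlane) {σ : ℂ}
    (hσ : Complex.exp (2 * Real.pi * Complex.I * σ) ^ N = 1) (z : ℂ) :
    V.genusTerm v l τ σ (z + τ) =
      Complex.exp (2 * Real.pi * Complex.I * σ) ^ u v * V.genusTerm v l τ σ z := by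
  rw [genusTerm, genusTerm, Finset.mul_sum]
  refine Finset.sum_congr rfl fun I hI => ?_
  obtain ⟨n, hn, hsum⟩ := V.exists_int_coordinates hI (p := v) (by rwa [hP I hI])
  rw [← V.prod_zpow_coordinates hu hN hσ hsum, mul_left_comm, ← Finset.prod_mul_distrib]
  congr 1
  refine Finset.prod_congr rfl fun i hi => ?_
  rw [hn i hi, ← neg_neg (n i), ← ellipticQuot_add_int_mul_tau]
  congr 1
  push_cast
  ring

/-- The elliptic genus stays bounded near every point. -/
theorem genusTerm_isBigO_one (V : Δ.EdgeVectors) (hΔ : Δ.IsComplete) (hP : V.GlobalType)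
    {N : ℕ} (hN : N ≠ 0) {u : Module.Dual ℤ L} (hu : ∀ i, (N : ℤ) ∣ 1 - u (V.vec i)) {v : L}
    (hgen : Δ.IsGeneric (latticeIncl L v)) (l : L) (τ : UpperHalfPlane) {σ : ℂ}
    (hσ : Complex.exp (2 * Real.pi * Complex.I * σ) ^ N = 1)
    (hσ' : Complex.exp (2 * Real.pi * Complex.I * σ) ≠ 1) (z₀ : ℂ) :
    V.genusTerm v l τ σ =O[𝓝[≠] z₀] fun _ => (1 : ℂ) := by
  classical
  set ζ := Complex.exp (2 * Real.pi * Complex.I * σ) with hζ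
  obtain ⟨x₀, y₀, hz₀⟩ := τ.exists_eq_add_mul z₀
  -- With these vectors the argument of the factor `i` of `I` at `z₀` is `⟨u_i^I, X⟩ + ⟨u_i^I, Y⟩
  -- τ`, a lattice point exactly when both pairings are integers.
  set X : ℝ ⊗[ℤ] L := -(x₀ • latticeIncl L v) - latticeIncl L l with hX
  set Y : ℝ ⊗[ℤ] L := -(y₀ • latticeIncl L v) with hY
  -- the set of vertices of `I` whose factor is regular at `z₀`
  set κ : Finset ι → Finset ι := fun I => I.filter fun i =>
    ¬ ∃ m n : ℤ, V.dual I i X = m ∧ V.dual I i Y = n with hκ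
  obtain ⟨c, g, hg, hg0, hgq⟩ :=
    exists_ellipticQuot_neg_eq (ne_int_add_int_mul_of_pow_eq_one hN hσ hσ' τ)
  have hclass : ∀ K ∈ Δ.facets.image κ, (∀ I ∈ Δ.facets, κ I = K ↔ K ⊆ I) ∧
      ∃ (d : ℂ) (f : ι → ℂ → ℂ), (∀ i, AnalyticAt ℂ (f i) 0) ∧
        ∀ I ∈ Δ.facets, K ⊆ I → ∀ s ≠ 0,
          ∏ i ∈ I, ellipticQuot (-((z₀ + s) * V.dual I i (latticeIncl L v)) -
            V.dual I i (latticeIncl L l)) τ σ =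
          d * (s ^ (Module.finrank ℤ L - K.card))⁻¹ *
            ((∏ i, f i (s * V.dual I i (latticeIncl L v))) /
              ∏ i ∈ I \ K, (V.dual I i (latticeIncl L v) : ℂ)) := by
    intro K hK
    obtain ⟨I₀, hI₀, hKI₀⟩ := Finset.mem_image.1 hK
    have hsub : K ⊆ I₀ := hKI₀ ▸ Finset.filter_subset _ _
    have hmemK : ∀ i ∈ I₀, i ∈ K ↔ ¬ ∃ m n : ℤ, V.dual I₀ i X = m ∧ V.dual I₀ i Y = n :=
      fun i hi => by rw [← hKI₀, hκ, Finset.mem_filter, and_iff_right hi]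
    have hint : ∀ i ∈ I₀ \ K, ∃ m n : ℤ, V.dual I₀ i X = m ∧ V.dual I₀ i Y = n :=
      fun i hi => by
        obtain ⟨h1, h2⟩ := Finset.mem_sdiff.1 hi
        rwa [hmemK i h1, not_not] at h2
    obtain ⟨p, hp, hpX⟩ := V.exists_dual_eq_add hP hI₀ hsub X fun i hi => by
      obtain ⟨m, -, hm, -⟩ := hint i hi
      exact ⟨m, hm⟩
    obtain ⟨p', hp', hpY⟩ := V.exists_dual_eq_add hP hI₀ hsub Y fun i hi => by
      obtain ⟨-, n, -, hn⟩ := hint i hi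
      exact ⟨n, hn⟩
    -- On the star of `K`, the coordinates of `X` and `Y` are those of `I₀` at `K`, zero elsewhere,
    -- plus the integer coordinates of `p` and `p'`; so integrality at each `i` is the same as in
    -- `I₀`, which shows `κ I = K`.
    refine ⟨fun I hI => ⟨fun h => h ▸ Finset.filter_subset _ _, fun hKI => ?_⟩, ?_⟩
    · obtain ⟨m, hm, -⟩ := V.exists_int_coordinates hI (p := p) (by rwa [hP I hI])
      obtain ⟨n, hn, -⟩ := V.exists_int_coordinates hI (p := p') (by rwa [hP I hI])
      ext i
      rw [hκ, Finset.mem_filter]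
      constructor
      · rintro ⟨hi, hnot⟩
        by_contra hiK
        refine hnot ⟨m i, n i, ?_, ?_⟩
        · rw [hpX I hI hKI i hi, if_neg hiK, zero_add, hm i hi]
        · rw [hpY I hI hKI i hi, if_neg hiK, zero_add, hn i hi]
      · refine fun hiK => ⟨hKI hiK, ?_⟩
        rintro ⟨m', n', hm', hn'⟩
        refine (hmemK i (hsub hiK)).1 hiK ⟨m' - m i, n' - n i, ?_, ?_⟩
        · rw [hpX I hI hKI i (hKI hiK), if_pos hiK, hm i (hKI hiK)] at hm'
          push_cast
          linarith
        · rw [hpY I hI hKI i (hKI hiK), if_pos hiK, hn i (hKI hiK)] at hn'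
          push_cast
          linarith
    -- Removing the lattice parts `p + p'τ` costs `∏ ζ^{-n_i}`, where the `n_i` are the coordinates
    -- of `p'`; this equals `ζ^{-u(p')}` independently of `I`. The factor `c` comes from each of the
    -- `n - |K|` poles.
    · refine ⟨ζ ^ (-u p') * c ^ (Module.finrank ℤ L - K.card), fun i => if i ∈ K then
        fun x => ellipticQuot (V.dual I₀ i X + V.dual I₀ i Y * τ - x) τ σ else g, ?_, ?_⟩
      · intro i
        by_cases hi : i ∈ K
        · simp only [if_pos hi]
          refine analyticAt_ellipticQuot (fun m n h => ?_) σ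
          refine (hmemK i (hsub hi)).1 hi ⟨m, n, ?_⟩
          exact τ.eq_of_add_mul_eq (by exact_mod_cast h)
        · simp only [if_neg hi]
          exact hg
      · intro I hI hKI s hs
        obtain ⟨m, hm, -⟩ := V.exists_int_coordinates hI (p := p) (by rwa [hP I hI])
        obtain ⟨n, hn, hnsum⟩ := V.exists_int_coordinates hI (p := p') (by rwa [hP I hI])
        have hshift : ∀ i ∈ I, ellipticQuot (-((z₀ + s) * V.dual I i (latticeIncl L v)) -
            V.dual I i (latticeIncl L l)) τ σ = (ζ ^ n i)⁻¹ *
              ellipticQuot ((if i ∈ K then (V.dual I₀ i X + V.dual I₀ i Y * τ : ℂ) else 0) -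
                s * V.dual I i (latticeIncl L v)) τ σ := by
          intro i hi
          have h1 := hpX I hI hKI i hi
          have h2 := hpY I hI hKI i hi
          rw [hm i hi] at h1
          rw [hn i hi] at h2
          rw [← zpow_neg, hζ, ← ellipticQuot_add_int_mul_tau, ← ellipticQuot_add_int _ τ σ (-m i)]
          congr 1
          have h1' : ((V.dual I i X : ℝ) : ℂ) =
              -(x₀ * V.dual I i (latticeIncl L v)) - V.dual I i (latticeIncl L l) := by
            rw [hX, map_sub, map_neg, map_smul, smul_eq_mul]
            push_cast
            rfl
          have h2' : ((V.dual I i Y : ℝ) : ℂ) = -(y₀ * V.dual I i (latticeIncl L v)) := by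
            rw [hY, map_neg, map_smul, smul_eq_mul]
            push_cast
            rfl
          have h3 := congrArg (fun r : ℝ => (r : ℂ)) h1
          have h4 := congrArg (fun r : ℝ => (r : ℂ)) h2
          simp only [h1', h2'] at h3 h4
          rw [hz₀]
          by_cases hiK : i ∈ K
          · simp only [if_pos hiK] at h3 h4 ⊢
            push_cast at h3 h4 ⊢
            linear_combination h3 + τ * h4
          · simp only [if_neg hiK] at h3 h4 ⊢
            push_cast at h3 h4 ⊢
            linear_combination h3 + τ * h4
        rw [Finset.prod_congr rfl hshift, Finset.prod_mul_distrib, Finset.prod_inv_distrib,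
          V.prod_zpow_coordinates hu hN hσ hnsum, ← zpow_neg]
        have hcard : (I \ K).card = Module.finrank ℤ L - K.card := by
          rw [Finset.card_sdiff_of_subset hKI, (mem_facets.1 hI).2]
        -- The indices outside `I` contribute `g 0 = 1`, so the product may run over all vertices,
        -- as `isBigO_analytic` requires.
        have hall : ∏ i, (if i ∈ K then
            fun x => ellipticQuot (V.dual I₀ i X + V.dual I₀ i Y * τ - x) τ σ else g)
              (s * V.dual I i (latticeIncl L v)) =
            ∏ i ∈ I, (if i ∈ K then
            fun x => ellipticQuot (V.dual I₀ i X + V.dual I₀ i Y * τ - x) τ σ else g)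
              (s * V.dual I i (latticeIncl L v)) := by
          refine (Finset.prod_subset (Finset.subset_univ I) fun i _ hi => ?_).symm
          rw [if_neg fun h => hi (hKI h), V.dual_eq_zero hi]
          simp [hg0]
        rw [hall, ← Finset.prod_sdiff hKI, ← Finset.prod_sdiff hKI]
        have hK1 : ∏ i ∈ K, ellipticQuot ((if i ∈ K then
            (V.dual I₀ i X + V.dual I₀ i Y * τ : ℂ) else 0) -
              s * V.dual I i (latticeIncl L v)) τ σ = ∏ i ∈ K, (if i ∈ K then
            fun x => ellipticQuot (V.dual I₀ i X + V.dual I₀ i Y * τ - x) τ σ else g)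
              (s * V.dual I i (latticeIncl L v)) :=
          Finset.prod_congr rfl fun i hi => by simp only [if_pos hi]
        have hK2 : ∏ i ∈ I \ K, ellipticQuot ((if i ∈ K then
            (V.dual I₀ i X + V.dual I₀ i Y * τ : ℂ) else 0) -
              s * V.dual I i (latticeIncl L v)) τ σ =
            c ^ (Module.finrank ℤ L - K.card) * (s ^ (Module.finrank ℤ L - K.card))⁻¹ *
            ((∏ i ∈ I \ K, (if i ∈ K then
            fun x => ellipticQuot (V.dual I₀ i X + V.dual I₀ i Y * τ - x) τ σ else g)
              (s * V.dual I i (latticeIncl L v))) /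
              ∏ i ∈ I \ K, (V.dual I i (latticeIncl L v) : ℂ)) := by
          rw [← hcard, ← Finset.prod_const, ← Finset.prod_const, ← Finset.prod_inv_distrib,
            ← Finset.prod_mul_distrib, ← Finset.prod_div_distrib, ← Finset.prod_mul_distrib]
          refine Finset.prod_congr rfl fun i hi => ?_
          obtain ⟨hiI, hiK⟩ := Finset.mem_sdiff.1 hi
          have hne : (V.dual I i (latticeIncl L v) : ℂ) ≠ 0 :=
            Complex.ofReal_ne_zero.2 (V.dual_ne_zero_of_isGeneric hgen hI hiI)
          rw [if_neg hiK, if_neg hiK, zero_sub, hgq _ (mul_ne_zero hs hne)]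
          field_simp
        rw [hK1, hK2]
        ring
  have hcomp : Tendsto (fun z => z - z₀) (𝓝[≠] z₀) (𝓝[≠] 0) := by
    refine tendsto_nhdsWithin_iff.2 ⟨?_, ?_⟩
    · have := (continuous_sub_right z₀).tendsto z₀
      rw [sub_self] at this
      exact this.mono_left nhdsWithin_le_nhds
    · filter_upwards [self_mem_nhdsWithin] with y hy
      simpa [sub_eq_zero] using hy
  have hmain : (fun s => V.genusTerm v l τ σ (z₀ + s)) =O[𝓝[≠] 0] fun _ => (1 : ℂ) := by
    simp_rw [genusTerm]
    have hfib : ∀ s : ℂ, ∑ I ∈ Δ.facets, (Δ.w I : ℂ) * ∏ i ∈ I,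
        ellipticQuot (-((z₀ + s) * V.dual I i (latticeIncl L v)) -
          V.dual I i (latticeIncl L l)) τ σ =
        ∑ K ∈ Δ.facets.image κ, ∑ I ∈ Δ.facets with κ I = K, (Δ.w I : ℂ) * ∏ i ∈ I,
        ellipticQuot (-((z₀ + s) * V.dual I i (latticeIncl L v)) -
          V.dual I i (latticeIncl L l)) τ σ := fun s =>
      (Finset.sum_fiberwise_of_maps_to (fun I hI => Finset.mem_image_of_mem κ hI) _).symm
    simp_rw [hfib]
    refine IsBigO.fun_sum fun K hK => ?_
    obtain ⟨hiff, d, f, hf, hprod⟩ := hclass K hK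
    -- The localization sum over the star vanishes to order `n - |K|`, exactly the order of the
    -- apparent pole.
    have hO := ((V.balancedWeights hΔ hP hgen).isBigO_analytic K hf).mono
      (nhdsWithin_le_nhds (s := {0}ᶜ))
    have hO' := ((isBigO_refl (fun s : ℂ => d * (s ^ (Module.finrank ℤ L - K.card))⁻¹)
      (𝓝[≠] 0)).mul hO).trans (g := fun s : ℂ => d * (s ^ (Module.finrank ℤ L - K.card))⁻¹ *
        s ^ (Module.finrank ℤ L - K.card)) (isBigO_refl _ _)
    have hd : (fun s : ℂ => d * (s ^ (Module.finrank ℤ L - K.card))⁻¹ *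
        s ^ (Module.finrank ℤ L - K.card)) =O[𝓝[≠] 0] fun _ => (1 : ℂ) := by
      refine ((isBigO_const_const d (one_ne_zero (α := ℂ)) (𝓝[≠] (0 : ℂ)))).congr' ?_
        EventuallyEq.rfl
      filter_upwards [self_mem_nhdsWithin] with s hs
      rw [mul_assoc, inv_mul_cancel₀ (pow_ne_zero _ hs), mul_one]
    refine (hO'.trans hd).congr' ?_ EventuallyEq.rfl
    filter_upwards [self_mem_nhdsWithin] with s hs
    rw [Finset.filter_congr hiff, Finset.mul_sum]
    refine Finset.sum_congr rfl fun I hI => ?_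
    obtain ⟨hIF, hKI⟩ := Finset.mem_filter.1 hI
    rw [hprod I hIF hKI s hs]
    ring
  refine (hmain.comp_tendsto hcomp).congr (fun z => ?_) fun _ => rfl
  simp

/-! ### The regular set -/

/-- Genericity makes each argument a nonconstant affine function of `z`. It takes the value `τ/2`,
which is not a lattice point, so each of the finitely many denominators is an entire function that
is not identically zero. -/
theorem regularSet_mem_codiscrete (V : Δ.EdgeVectors) {v : L}
    (hgen : Δ.IsGeneric (latticeIncl L v)) (τ : UpperHalfPlane) :
    V.regularSet v τ ∈ codiscrete ℂ := by
  have hmem : ∀ (I : Δ.facets) (h : V.quot I) (i : I.1),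
      ∀ᶠ z in codiscrete ℂ, ellipticPhi (V.genusArg v z I h i) τ ≠ 0 := by
    intro I h i
    have hd : Differentiable ℂ fun z => ellipticPhi (V.genusArg v z I h i) τ := by
      unfold genusArg
      exact (differentiable_ellipticPhi τ).comp (g := fun z => ellipticPhi z τ) (by fun_prop)
    have ha : (V.pairing I i v : ℂ) ≠ 0 := by
      rw [V.pairing_eq_dual]
      exact Complex.ofReal_ne_zero.2 (V.dual_ne_zero_of_isGeneric hgen I.2 i.2)
    refine AnalyticOnNhd.preimage_zero_mem_codiscrete (fun z _ => hd.analyticAt z)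
      (x := -((τ : ℂ) / 2 + V.pairing I i (Quotient.out h)) / V.pairing I i v) ?_
    have harg : V.genusArg v (-((τ : ℂ) / 2 + V.pairing I i (Quotient.out h)) /
        V.pairing I i v) I h i = τ / 2 := by
      rw [genusArg, div_mul_cancel₀ _ ha]
      ring
    rw [harg]
    refine ellipticPhi_ne_zero fun m n hmn => ?_
    have h2 := (τ.eq_of_add_mul_eq (x := 0) (y := 1 / 2) (x' := m) (y' := n) (by
      push_cast
      linear_combination hmn)).2
    have h3 : ((1 : ℤ) : ℝ) = ((2 * n : ℤ) : ℝ) := by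
      push_cast
      linarith
    have h4 : (1 : ℤ) = 2 * n := by exact_mod_cast h3
    omega
  have : ∀ᶠ z in codiscrete ℂ, ∀ (I : Δ.facets) (h : V.quot I) (i : I.1),
      ellipticPhi (V.genusArg v z I h i) τ ≠ 0 :=
    eventually_all.2 fun I => eventually_all.2 fun h => eventually_all.2 fun i => hmem I h i
  exact this

theorem differentiableAt_ellipticGenus (V : Δ.EdgeVectors) {v : L} {τ : UpperHalfPlane} (σ : ℂ)
    {z : ℂ} (hz : z ∈ V.regularSet v τ) :
    DifferentiableAt ℂ (fun z => V.ellipticGenus v z τ σ) z := by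
  unfold ellipticGenus
  refine DifferentiableAt.fun_sum fun I _ => DifferentiableAt.const_mul
    (DifferentiableAt.fun_sum fun h _ => DifferentiableAt.fun_finsetProd fun i _ => ?_) _
  have hd := differentiable_ellipticPhi τ
  have ha : Differentiable ℂ fun z => V.genusArg v z I h i := by
    unfold genusArg
    fun_prop
  have h1 : Differentiable ℂ fun z => ellipticPhi (V.genusArg v z I h i + σ) τ :=
    hd.comp (g := fun z => ellipticPhi z τ) (ha.add_const σ)
  have h2 : Differentiable ℂ fun z => ellipticPhi (V.genusArg v z I h i) τ :=
    hd.comp (g := fun z => ellipticPhi z τ) ha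
  exact (h1 z).div (h2 z) (hz I h i)

end SimplicialMultiFan.EdgeVectors

end LevelGenus

/-! ### Rigidity -/

theorem mainTheorem2 {ι : Type*} [Fintype ι] [DecidableEq ι]
    {L : Type*} [AddCommGroup L] [Module.Free ℤ L] [Module.Finite ℤ L]
    (Δ : SimplicialMultiFan ι L) (hΔ : Δ.IsComplete)
    (V : Δ.EdgeVectors) (hP : V.GlobalType)
    (v : L) (hv : v ∈ V.latInf) (hgen : Δ.IsGeneric (latticeIncl L v))
    (N : ℕ) (hN : 1 < N) (hc : V.ChernDivisible N)
    (τ : UpperHalfPlane) (σ : ℂ)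
    (hσ : Complex.exp (2 * Real.pi * Complex.I * σ) ^ N = 1)
    (hσ' : Complex.exp (2 * Real.pi * Complex.I * σ) ≠ 1) :
    V.regularSet v τ ∈ Filter.codiscrete ℂ ∧
      ∃ c : ℂ, ∀ z ∈ V.regularSet v τ, V.ellipticGenus v z τ σ = c := by
  have hN0 : N ≠ 0 := by omega
  obtain ⟨u, hu⟩ := hc.exists_dual
  obtain ⟨κ, s, hgenus⟩ := V.exists_ellipticGenus_eq_sum_genusTerm hP v τ σ
  have hR := V.regularSet_mem_codiscrete hgen τ
  refine ⟨hR, exists_eq_const_of_doublyPeriodic_norm τ hR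
    (G := fun z => V.ellipticGenus v z τ σ)
    (fun z hz => V.differentiableAt_ellipticGenus σ hz) (fun z => ?_) (fun z => ?_) fun z => ?_⟩
  · simp_rw [hgenus]
    exact (Asymptotics.IsBigO.fun_sum fun l _ =>
      V.genusTerm_isBigO_one hΔ hP hN0 hu hgen l τ hσ hσ' z).const_mul_left κ
  · simp_rw [hgenus, V.genusTerm_add_one hP hv]
  -- The multiplier `ζ^{u(v)}` is the same for all `l` and has absolute value `1`; this is why only
  -- `|G|` is asked to be periodic.
  · simp_rw [hgenus, V.genusTerm_add_tau hP hN0 hu hv _ τ hσ]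
    rw [← Finset.mul_sum, mul_left_comm, norm_mul, norm_zpow,
      Complex.norm_eq_one_of_pow_eq_one hσ hN0, one_zpow, one_mul]
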